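/- Let $g \ge 0$ be an integer. Let $M_g \simeq \mathbb{C}^{3g+1}$ be the affine space, with coordinates $u_0,\dots,u_{g-1},v_0,\dots,v_{g-1},w_0,\dots,w_g$, of matrices $$A(x)=\begin{pmatrix} v(x) & u(x)\\ w(x) & -v(x)\end{pmatrix},\qquad u(x)=x^g+\sum_{i=0}^{g-1}u_ix^i,\quad v(x)=\sum_{i=0}^{g-1}v_ix^i,\quad w(x)=x^{g+1}+\sum_{i=0}^{g}w_ix^i .$$ With $u_g=1$, $w_{g+1}=1$ and all other coefficients outside the above ranges equal to $0$, equip $M_g$ with the Poisson bracket $$\{u_i,u_j\}=\{v_i,v_j\}=0,\quad \{u_i,v_j\}=u_{i+j+1},\quad \{u_i,w_j\}=-2v_{i+j+1},$$ $$\{v_i,w_j\}=w_{i+j+1}-\delta_{0,j}u_i,\quad \{w_i,w_j\}=2(\delta_{0,j}v_i-\delta_{i,0}v_j).$$ Let $\mathbf{H}(A)=-\det A(x)=v(x)^2+u(x)w(x)=x^{2g+1}+\sum_{i=0}^{2g}h_i(A)x^i$ be the moment map, and let $D_i=\{\cdot,h_i\}$ be the Hamiltonian vector field of $h_i$. Let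 $H_g$ be the set of monic polynomials of degree $2g+1$ in $\mathbb{C}[x]$. For $h\in H_g$ put $$M_g(h)=\{A\in M_g : \mathbf{H}(A)=h\},\qquad M_{g,g}(h)=\{A\in M_g(h) : \dim\langle D_0|_A,\dots,D_{g-1}|_A\rangle=g\}.$$ Varieties are complex, reduced and not necessarily irreducible; closures are Zariski closures. For every $h\in H_g$, the maximal stratum $M_{g,g}(h)$ is a smooth quasi-affine variety of dimension $g$ (its dimension is $g$, and the local ring at each of its points is regular of dimension $g$), and its boundary $\overline{M_{g,g}(h)}\setminus M_{g,g}(h)$ is exactly the set of singular points of $M_g(h)$. In particular, every fibre $M_g(h)$ is an affine variety of dimension $g$. -/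

import Mathlib

open scoped Polynomial

noncomputable section

namespace Mumford

/-! ### Classical complex affine varieties

Varieties are sets of points of a complex affine space with its Zariski topology; they are reduced
and need not be irreducible. -/

/-- The complex affine space with coordinates indexed by `σ`, carrying the Zariski topology
(and not the product topology). -/
def AffSp (σ : Type) : Type := σ → ℂ

/-- The coordinates of a point. -/
def coords {σ : Type} : AffSp σ ≃ (σ → ℂ) := Equiv.refl _

/-- The Zariski topology, induced from the prime spectrum of the polynomial ring by sending a point
to the maximal ideal of polynomials vanishing there. -/
instance (σ : Type) : TopologicalSpace (AffSp σ) :=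
  TopologicalSpace.induced
    (fun p : AffSp σ => (MvPolynomial.pointToPoint (coords p) : PrimeSpectrum (MvPolynomial σ ℂ)))
    inferInstance

/-- The closed sets are exactly the zero loci of ideals of polynomials. -/
theorem isClosed_iff_zeroLocus {σ : Type} (S : Set (AffSp σ)) :
    IsClosed S ↔ ∃ I : Ideal (MvPolynomial σ ℂ), S = coords ⁻¹' MvPolynomial.zeroLocus ℂ I := by
  have key : ∀ I : Ideal (MvPolynomial σ ℂ),
      (fun p : AffSp σ =>
        (MvPolynomial.pointToPoint (coords p) : PrimeSpectrum (MvPolynomial σ ℂ))) ⁻¹'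
          PrimeSpectrum.zeroLocus (I : Set (MvPolynomial σ ℂ)) =
        coords ⁻¹' MvPolynomial.zeroLocus ℂ I := by
    intro I
    ext x
    simp only [Set.mem_preimage, PrimeSpectrum.mem_zeroLocus, MvPolynomial.mem_zeroLocus_iff,
      MvPolynomial.pointToPoint]
    exact ⟨fun h p hp => (MvPolynomial.mem_vanishingIdeal_singleton_iff (coords x) p).1 (h hp),
      fun h p hp => (MvPolynomial.mem_vanishingIdeal_singleton_iff (coords x) p).2 (h p hp)⟩
  constructor
  · intro h
    obtain ⟨T, hT, rfl⟩ := isClosed_induced_iff.1 h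
    obtain ⟨I, rfl⟩ := (PrimeSpectrum.isClosed_iff_zeroLocus_ideal T).1 hT
    exact ⟨I, key I⟩
  · rintro ⟨I, rfl⟩
    exact isClosed_induced_iff.2
      ⟨_, PrimeSpectrum.isClosed_zeroLocus (I : Set (MvPolynomial σ ℂ)), key I⟩

/-- An affine variety: a Zariski closed set of an affine space. -/
def IsAffineVariety {σ : Type} (S : Set (AffSp σ)) : Prop := IsClosed S

/-- A quasi-affine variety: a Zariski open subset of a Zariski closed set of an affine space. -/
def IsQuasiAffineVariety {σ : Type} (S : Set (AffSp σ)) : Prop := IsLocallyClosed S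

/-- The dimension of a variety: the supremum of the lengths of chains of irreducible closed
subsets (it is `⊥` for the empty set). -/
def dim {σ : Type} (S : Set (AffSp σ)) : WithBot ℕ∞ := topologicalKrullDim S

/-- The ring of polynomial functions on `S`, i.e. the coordinate ring of the Zariski closure. -/
abbrev CoordRing {σ : Type} (S : Set (AffSp σ)) : Type :=
  MvPolynomial σ ℂ ⧸ (MvPolynomial.vanishingIdeal ℂ (coords '' S) : Ideal (MvPolynomial σ ℂ))

/-- Evaluation of polynomial functions on `S` at a point of `S`. -/
def evalAt {σ : Type} (S : Set (AffSp σ)) (p : S) : CoordRing S →+* ℂ :=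
  Ideal.Quotient.lift _ (MvPolynomial.aeval (R := ℂ) (coords p.1)).toRingHom
    fun _ hf => hf (coords p.1) ⟨p.1, p.2, rfl⟩

instance {σ : Type} (S : Set (AffSp σ)) (p : S) : (RingHom.ker (evalAt S p)).IsPrime :=
  RingHom.ker_isPrime _

/-- The local ring of the variety `S` at its point `p`: the localization of the ring of polynomial
functions at the maximal ideal of functions vanishing at `p`. For a quasi-affine `S`, which is open
in its closure, this is the ring of germs at `p` of regular functions on `S`. -/
abbrev LocalRingAt {σ : Type} (S : Set (AffSp σ)) (p : S) : Type :=
  Localization.AtPrime (RingHom.ker (evalAt S p))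

/-- `S` is smooth at `p` if its local ring at `p` is regular. -/
def IsSmoothAt {σ : Type} (S : Set (AffSp σ)) (p : S) : Prop :=
  IsRegularLocalRing (LocalRingAt S p)

/-- The set of singular points of `S`. -/
def singularLocus {σ : Type} (S : Set (AffSp σ)) : Set (AffSp σ) :=
  {p | ∃ hp : p ∈ S, ¬ IsSmoothAt S ⟨p, hp⟩}

/-- `S` is smooth of dimension `d`: it has dimension `d`, it is smooth at each of its points, and
its dimension at each of its points is `d` (so all its irreducible components have
dimension `d`). -/
def IsSmoothOfDim {σ : Type} (S : Set (AffSp σ)) (d : ℕ) : Prop :=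
  dim S = d ∧ ∀ p : S, IsSmoothAt S p ∧ ringKrullDim (LocalRingAt S p) = d

/-- The boundary of a stratum: its Zariski closure minus the stratum itself. -/
def boundary {σ : Type} (S : Set (AffSp σ)) : Set (AffSp σ) := closure S \ S

/-! ### The Mumford system -/

/-- Indices of the `3g+1` coordinates `u_0, …, u_{g-1}`, `v_0, …, v_{g-1}`, `w_0, …, w_g`,
in this order. -/
abbrev Coord (g : ℕ) : Type := Fin g ⊕ Fin g ⊕ Fin (g + 1)

section Polynomials

variable {R : Type} [CommRing R] {g : ℕ}

/-- `u(x) = x^g + u_{g-1} x^{g-1} + ⋯ + u_0`. -/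
def uPoly (a : Coord g → R) : R[X] :=
  Polynomial.X ^ g + ∑ i : Fin g, Polynomial.C (a (.inl i)) * Polynomial.X ^ (i : ℕ)

/-- `v(x) = v_{g-1} x^{g-1} + ⋯ + v_0`. -/
def vPoly (a : Coord g → R) : R[X] :=
  ∑ i : Fin g, Polynomial.C (a (.inr (.inl i))) * Polynomial.X ^ (i : ℕ)

/-- `w(x) = x^{g+1} + w_g x^g + ⋯ + w_0`. -/
def wPoly (a : Coord g → R) : R[X] :=
  Polynomial.X ^ (g + 1) +
    ∑ i : Fin (g + 1), Polynomial.C (a (.inr (.inr i))) * Polynomial.X ^ (i : ℕ)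

/-- The traceless polynomial matrix with rows `(v(x), u(x))` and `(w(x), -v(x))`. -/
def polyMatrix (a : Coord g → R) : Matrix (Fin 2) (Fin 2) R[X] :=
  !![vPoly a, uPoly a; wPoly a, -vPoly a]

/-- The moment map `A ↦ -det A(x) = v(x)² + u(x) w(x)`. -/
def momentMap (a : Coord g → R) : R[X] := -(polyMatrix a).det

end Polynomials

/-- The phase space `M_g`, an affine space of dimension `3g+1`: a matrix `A(x)` is given by the
coefficients of its entries, and is recovered as `polyMatrix (coords A)`. -/
abbrev PhaseSpace (g : ℕ) : Type := AffSp (Coord g)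

/-- The set `H_g` of monic polynomials of degree `2g+1`. -/
def monicPolys (g : ℕ) : Set ℂ[X] := {h | h.Monic ∧ h.natDegree = 2 * g + 1}

/-- The fibre `M_g(h)` of the moment map. -/
def fibre (g : ℕ) (h : ℂ[X]) : Set (PhaseSpace g) := {A | momentMap (coords A) = h}

/-- The coefficient `u_k` as a function on the phase space, with `u_g = 1` and `u_k = 0` for
`k > g`. -/
def uFun (g k : ℕ) : MvPolynomial (Coord g) ℂ :=
  (uPoly (MvPolynomial.X : Coord g → MvPolynomial (Coord g) ℂ)).coeff k

/-- The coefficient `v_k` as a function on the phase space, with `v_k = 0` for `k ≥ g`. -/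
def vFun (g k : ℕ) : MvPolynomial (Coord g) ℂ :=
  (vPoly (MvPolynomial.X : Coord g → MvPolynomial (Coord g) ℂ)).coeff k

/-- The coefficient `w_k` as a function on the phase space, with `w_{g+1} = 1` and `w_k = 0` for
`k > g + 1`. -/
def wFun (g k : ℕ) : MvPolynomial (Coord g) ℂ :=
  (wPoly (MvPolynomial.X : Coord g → MvPolynomial (Coord g) ℂ)).coeff k

/-- The Poisson brackets of the coordinate functions:
`{u_i, u_j} = {v_i, v_j} = 0`, `{u_i, v_j} = u_{i+j+1}`, `{u_i, w_j} = -2 v_{i+j+1}`,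
`{v_i, w_j} = w_{i+j+1} - δ_{0,j} u_i`, `{w_i, w_j} = 2 (δ_{0,j} v_i - δ_{i,0} v_j)`. -/
def coordBracket (g : ℕ) : Coord g → Coord g → MvPolynomial (Coord g) ℂ
  | .inl _, .inl _ => 0
  | .inl i, .inr (.inl j) => uFun g (i + j + 1)
  | .inr (.inl i), .inl j => -uFun g (j + i + 1)
  | .inr (.inl _), .inr (.inl _) => 0
  | .inl i, .inr (.inr j) => -2 * vFun g (i + j + 1)
  | .inr (.inr i), .inl j => 2 * vFun g (j + i + 1)
  | .inr (.inl i), .inr (.inr j) =>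
      wFun g (i + j + 1) - (if (j : ℕ) = 0 then uFun g i else 0)
  | .inr (.inr i), .inr (.inl j) =>
      -(wFun g (j + i + 1) - (if (i : ℕ) = 0 then uFun g j else 0))
  | .inr (.inr i), .inr (.inr j) =>
      2 * ((if (j : ℕ) = 0 then vFun g i else 0) - (if (i : ℕ) = 0 then vFun g j else 0))

/-- The Poisson bracket on polynomial functions, the biderivation extending `coordBracket`. -/
def poissonBracket (g : ℕ) (F G : MvPolynomial (Coord g) ℂ) : MvPolynomial (Coord g) ℂ :=
  ∑ a : Coord g, ∑ b : Coord g,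
    coordBracket g a b * MvPolynomial.pderiv a F * MvPolynomial.pderiv b G

/-- The function `h_i` on the phase space: the coefficient of `x^i` in `v(x)² + u(x) w(x)`. -/
def hFun (g i : ℕ) : MvPolynomial (Coord g) ℂ :=
  (momentMap (MvPolynomial.X : Coord g → MvPolynomial (Coord g) ℂ)).coeff i

/-- The value `D_i|_A` at `A` of the Hamiltonian vector field `D_i = {·, h_i}`, as the vector of
its components in the coordinates. -/
def hamiltonianField (g i : ℕ) (A : PhaseSpace g) : Coord g → ℂ := fun c =>
  MvPolynomial.eval (coords A) (poissonBracket g (MvPolynomial.X c) (hFun g i))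

/-- The stratum `M_{g,i}`: the points `A` where the span of `D_0|_A, …, D_{g-1}|_A` has
dimension `i`. -/
def stratum (g i : ℕ) : Set (PhaseSpace g) :=
  {A | Module.finrank ℂ
    (Submodule.span ℂ (Set.range fun k : Fin g => hamiltonianField g k A)) = i}

/-- The stratum `M_{g,i}(h) = M_g(h) ∩ M_{g,i}` of the fibre. -/
def fibreStratum (g i : ℕ) (h : ℂ[X]) : Set (PhaseSpace g) := fibre g h ∩ stratum g i

end Mumford

end

/-!
At a point of the fibre with coordinates in a field `K`, the moment map equation reads
`v² + u w = h` in `K[x]`. The monic greatest common divisor `d` of the entries `u`, `v`, `w` divides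
`h`, hence has coefficients in `ℂ`. A vector tangent to the closure of the point therefore changes
the entries by multiples of `d`, so it is `d` times a syzygy of `(w, 2v, u) / d`, and such syzygies
form a space of dimension at most `g - deg d`. Thus every prime over the ideal of the `2g+1`
equations of the fibre has height at least `2g+1`, and the entries are coprime at those of height
`2g+1`. The fibre is then a complete intersection of dimension `g`, by Macaulay's unmixedness
theorem it is reduced, and the matrices with coprime entries form a dense open subset, on which the
differentials of `h_0, …, h_{2g}` are independent. A common root of the entries makes them
dependent, so by the Jacobian criterion this subset is the smooth locus.

It is also the maximal stratum. Where the `dh_i` are independent, those with `i ≥ g` span the kernel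
of the Poisson tensor, because `D_i = 0` for `i ≥ g` and this kernel has dimension at most `g + 1`;
hence `D_0, …, D_{g-1}` are independent. A common root `x` of the entries gives the relation
`∑ i < g, x^i D_i = 0`.
-/

section RegularLocalRing

open IsLocalRing RingTheory.Sequence
open scoped Pointwise

/-- `M` has depth at least `n`: there is an `M`-regular sequence of length `n` in the maximal ideal
of `R`. -/
def HasDepthAtLeast (R M : Type*) [CommRing R] [IsLocalRing R] [AddCommGroup M] [Module R M]
    (n : ℕ) : Prop :=
  ∃ rs : List R, rs.length = n ∧ (∀ r ∈ rs, r ∈ maximalIdeal R) ∧ IsRegular M rs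

theorem HasDepthAtLeast.congr {R M N : Type*} [CommRing R] [IsLocalRing R] [AddCommGroup M]
    [Module R M] [AddCommGroup N] [Module R N] {n : ℕ} (h : HasDepthAtLeast R M n)
    (e : M ≃ₗ[R] N) : HasDepthAtLeast R N n :=
  let ⟨rs, hlen, hmem, hrs⟩ := h
  ⟨rs, hlen, hmem, (e.isRegular_congr rs).1 hrs⟩

theorem HasDepthAtLeast.of_quotSMulTop {R M : Type*} [CommRing R] [IsLocalRing R] [AddCommGroup M]
    [Module R M] {n : ℕ} {x : R} (hx : x ∈ maximalIdeal R) (hreg : IsSMulRegular M x)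
    (h : HasDepthAtLeast R (QuotSMulTop x M) n) : HasDepthAtLeast R M (n + 1) :=
  let ⟨rs, hlen, hmem, hrs⟩ := h
  ⟨x :: rs, by rw [List.length_cons, hlen], List.forall_mem_cons.2 ⟨hx, hmem⟩,
    (isRegular_cons_iff M x rs).2 ⟨hreg, hrs⟩⟩

variable {R : Type*} [CommRing R] [IsLocalRing R]

theorem HasDepthAtLeast.of_quotient_ring {I : Ideal R} [IsLocalRing (R ⧸ I)] {n : ℕ}
    (h : HasDepthAtLeast (R ⧸ I) (R ⧸ I) n) : HasDepthAtLeast R (R ⧸ I) n := by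
  obtain ⟨rs, hlen, hmem, hrs⟩ := h
  obtain ⟨ss, rfl⟩ := List.map_surjective_iff.2 Ideal.Quotient.mk_surjective rs
  have hss : ∀ s ∈ ss, s ∈ maximalIdeal R := fun s hs =>
    (mem_maximalIdeal s).2 fun hu =>
      (mem_maximalIdeal _).1 (hmem _ (List.mem_map_of_mem hs)) (hu.map (Ideal.Quotient.mk I))
  exact ⟨ss, by simpa using hlen, hss, .of_isWeaklyRegular_of_mem_maximalIdeal _ hss
    ((isWeaklyRegular_map_algebraMap_iff (R ⧸ I) (R ⧸ I) ss).1 hrs.toIsWeaklyRegular)⟩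

theorem isLocalRing_quotient_span_singleton {x : R} (hx : x ∈ maximalIdeal R) :
    IsLocalRing (R ⧸ Ideal.span {x}) :=
  have : Nontrivial (R ⧸ Ideal.span {x}) := Ideal.Quotient.nontrivial_iff.2
    (Ideal.span_singleton_ne_top ((mem_maximalIdeal x).1 hx))
  .of_surjective' _ Ideal.Quotient.mk_surjective

theorem map_mk_maximalIdeal (I : Ideal R) [IsLocalRing (R ⧸ I)] :
    (maximalIdeal R).map (Ideal.Quotient.mk I) = maximalIdeal (R ⧸ I) := by
  have := IsLocalHom.of_surjective _ (Ideal.Quotient.mk_surjective (I := I))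
  have hcomap : (maximalIdeal (R ⧸ I)).comap (Ideal.Quotient.mk I) = maximalIdeal R :=
    ((local_hom_TFAE (Ideal.Quotient.mk I)).out 0 4).1 this
  rw [← hcomap, Ideal.map_comap_of_surjective _ Ideal.Quotient.mk_surjective]

/-- Steinitz exchange: an element outside `𝔪 N` can replace one of the generators of `N`. -/
theorem exists_card_add_one_span_insert_eq {M : Type*} [AddCommGroup M] [Module R M]
    (s : Finset M) {x : M} (hx : x ∈ Submodule.span R (s : Set M))
    (hx' : x ∉ maximalIdeal R • Submodule.span R (s : Set M)) :
    ∃ t : Finset M, t.card + 1 = s.card ∧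
      Submodule.span R (insert x (t : Set M)) = Submodule.span R (s : Set M) := by
  classical
  obtain ⟨f, -, rfl⟩ := Submodule.mem_span_finset.1 hx
  obtain ⟨j, hj, hu⟩ : ∃ j ∈ s, IsUnit (f j) := by
    by_contra! hcon
    exact hx' (Submodule.sum_mem _ fun a ha => Submodule.smul_mem_smul
      ((mem_maximalIdeal _).2 (hcon a ha)) (Submodule.subset_span ha))
  refine ⟨s.erase j, Finset.card_erase_add_one hj, le_antisymm
    (Submodule.span_le.2 (Set.insert_subset hx ?_)) (Submodule.span_le.2 fun a ha => ?_)⟩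
  · exact (Finset.coe_subset.2 (s.erase_subset j)).trans Submodule.subset_span
  · obtain rfl | haj := eq_or_ne a j
    · rw [SetLike.mem_coe, ← Submodule.smul_mem_iff_of_isUnit _ hu,
        ← (Submodule.span R _).add_mem_iff_left (y := ∑ b ∈ s.erase a, f b • b) ?_,
        Finset.add_sum_erase s (fun b => f b • b) hj]
      · exact Submodule.subset_span (Set.mem_insert _ _)
      · exact Submodule.sum_mem _ fun b hb => Submodule.smul_mem _ _
          (Submodule.subset_span (Set.mem_insert_of_mem _ hb))
    · exact Submodule.subset_span (Set.mem_insert_of_mem _ (Finset.mem_erase.2 ⟨haj, ha⟩))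

theorem spanFinrank_maximalIdeal_quotient_add_one_le [IsNoetherianRing R] {x : R}
    (hx : x ∈ maximalIdeal R) (hx2 : x ∉ maximalIdeal R ^ 2)
    [IsLocalRing (R ⧸ Ideal.span {x})] :
    (maximalIdeal (R ⧸ Ideal.span {x})).spanFinrank + 1 ≤ (maximalIdeal R).spanFinrank := by
  classical
  obtain ⟨s, hcard, hspan⟩ :=
    (IsNoetherian.noetherian (maximalIdeal R)).exists_span_finset_card_eq_spanFinrank
  obtain ⟨t, ht, htspan⟩ := exists_card_add_one_span_insert_eq s (hspan.symm ▸ hx)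
    (by rwa [hspan, smul_eq_mul, ← pow_two])
  have hmap : Ideal.span (t.image (Ideal.Quotient.mk (Ideal.span {x})) : Set (R ⧸ Ideal.span {x}))
      = maximalIdeal (R ⧸ Ideal.span {x}) := by
    rw [← map_mk_maximalIdeal, ← hspan, ← htspan, ← Ideal.span, Ideal.map_span,
      Set.image_insert_eq, Ideal.Quotient.eq_zero_iff_mem.2 (Ideal.mem_span_singleton_self x),
      Ideal.span_insert_zero, Finset.coe_image]
  rw [← hmap, ← hcard, ← ht]
  gcongr
  exact (Submodule.spanFinrank_span_le_ncard_of_finite (Finset.finite_toSet _)).trans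
    ((Set.ncard_coe_finset _).trans_le Finset.card_image_le)

/-- Nakayama: a minimal prime `q ≤ (x)` avoiding `x` satisfies `q = x q`. -/
theorem isDomain_of_isPrime_span_singleton [IsNoetherianRing R] {x : R} (hx : x ∈ maximalIdeal R)
    (hmin : ∀ q ∈ minimalPrimes R, x ∉ q) (hprime : (Ideal.span {x}).IsPrime) : IsDomain R := by
  obtain ⟨q, hq, hqle⟩ := Ideal.exists_minimalPrimes_le (I := ⊥) (J := Ideal.span {x}) bot_le
  have hqp : q.IsPrime := hq.1.1
  have hq0 : q = ⊥ := by
    refine Submodule.eq_bot_of_le_smul_of_le_jacobson_bot (Ideal.span {x}) q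
      (IsNoetherian.noetherian q) (fun a ha => ?_) ?_
    · obtain ⟨b, rfl⟩ := Ideal.mem_span_singleton'.1 (hqle ha)
      rw [mul_comm]
      exact Submodule.smul_mem_smul (Ideal.mem_span_singleton_self x)
        ((hqp.mem_or_mem ha).resolve_right (hmin q hq))
    · rwa [jacobson_eq_maximalIdeal _ bot_ne_top, Ideal.span_singleton_le_iff_mem]
  have : (⊥ : Ideal R).IsPrime := hq0 ▸ hqp
  exact (RingEquiv.quotientBot R).symm.toMulEquiv.isDomain _

theorem exists_mem_maximalIdeal_notMem_sq_notMem_minimalPrimes [IsNoetherianRing R]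
    (h : ringKrullDim R ≠ 0) :
    ∃ x ∈ maximalIdeal R, x ∉ maximalIdeal R ^ 2 ∧ ∀ q ∈ minimalPrimes R, x ∉ q := by
  by_contra! hcon
  have hcover : (maximalIdeal R : Set R) ⊆
      ⋃ i ∈ insert (maximalIdeal R ^ 2) (minimalPrimes R), (i : Set R) := fun x hx => by
    by_cases hx2 : x ∈ maximalIdeal R ^ 2
    · exact Set.mem_biUnion (Set.mem_insert _ _) hx2
    · obtain ⟨q, hq, hxq⟩ := hcon x hx hx2
      exact Set.mem_biUnion (Set.mem_insert_of_mem _ hq) hxq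
  obtain ⟨i, hi, hle⟩ := (Ideal.subset_union_prime_finite
    ((minimalPrimes.finite_of_isNoetherianRing R).insert _) (f := id) (maximalIdeal R ^ 2)
    (maximalIdeal R ^ 2) fun i hi h1 _ => (Set.mem_of_mem_insert_of_ne hi h1).1.1).1 hcover
  obtain rfl | hi := Set.mem_insert_iff.1 hi
  · exact (maximalIdeal_sq_lt_of_ringKrullDim_ne_zero h).not_ge hle
  · have : i.IsPrime := hi.1.1
    have hi_eq : i = maximalIdeal R := le_antisymm (le_maximalIdeal this.ne_top) hle
    rw [← maximalIdeal_height_eq_ringKrullDim, ← hi_eq, Ideal.height_eq_zero_iff.2 hi] at h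
    exact h rfl

theorem isRegularLocalRing_quotient_span_singleton {R : Type*} [CommRing R] [IsRegularLocalRing R]
    {x : R} (hx : x ∈ maximalIdeal R) (hx2 : x ∉ maximalIdeal R ^ 2) :
    IsRegularLocalRing (R ⧸ Ideal.span {x}) := by
  have := isLocalRing_quotient_span_singleton hx
  refine .of_spanFinrank_maximalIdeal_le _ (ENat.WithBot.add_le_add_one_right_iff.1 ?_)
  calc ((maximalIdeal (R ⧸ Ideal.span {x})).spanFinrank : WithBot ℕ∞) + 1
      ≤ (maximalIdeal R).spanFinrank := mod_cast spanFinrank_maximalIdeal_quotient_add_one_le hx hx2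
    _ = (maximalIdeal R).height := by
      rw [IsRegularLocalRing.spanFinrank_maximalIdeal, maximalIdeal_height_eq_ringKrullDim]
    _ ≤ ringKrullDim (R ⧸ Ideal.span {x}) + 1 := Ideal.height_le_ringKrullDim_quotient_add_one hx

theorem isDomain_and_hasDepthAtLeast_of_spanFinrank_eq (n : ℕ) :
    ∀ (R : Type*) [CommRing R] [IsRegularLocalRing R], (maximalIdeal R).spanFinrank = n →
      IsDomain R ∧ HasDepthAtLeast R R n := by
  induction n with
  | zero =>
    intro R _ _ h
    have hbot : maximalIdeal R = ⊥ :=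
      (Submodule.spanFinrank_eq_zero_iff_eq_bot (IsNoetherian.noetherian _)).1 h
    exact ⟨(isField_iff_maximalIdeal_eq.2 hbot).isDomain, [], rfl, by simp, IsRegular.nil R R⟩
  | succ n ih =>
    intro R _ _ h
    have hdim : ringKrullDim R = n + 1 := by
      rw [← IsRegularLocalRing.spanFinrank_maximalIdeal, h, Nat.cast_succ]
    obtain ⟨x, hx, hx2, hxmin⟩ := exists_mem_maximalIdeal_notMem_sq_notMem_minimalPrimes (R := R)
      (hdim.trans_ne (mod_cast n.succ_ne_zero))
    have := isRegularLocalRing_quotient_span_singleton hx hx2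
    have hle := spanFinrank_maximalIdeal_quotient_add_one_le hx hx2
    have hge : n ≤ (maximalIdeal (R ⧸ Ideal.span {x})).spanFinrank := by
      have := Ideal.height_le_ringKrullDim_quotient_add_one hx
      rw [maximalIdeal_height_eq_ringKrullDim, hdim,
        ← IsRegularLocalRing.spanFinrank_maximalIdeal (R := R ⧸ Ideal.span {x})] at this
      exact Nat.le_of_succ_le_succ (mod_cast this)
    obtain ⟨hdom, hdepth⟩ := ih (R ⧸ Ideal.span {x}) (by omega)
    have hdomR := isDomain_of_isPrime_span_singleton hx hxmin
      ((Ideal.Quotient.isDomain_iff_prime _).1 hdom)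
    have hx0 : x ≠ 0 := fun h0 => hx2 (h0 ▸ zero_mem _)
    have hspan : Ideal.span {x} = x • (⊤ : Ideal R) := by
      rw [← Submodule.ideal_span_singleton_smul, smul_eq_mul, Ideal.mul_top]
    exact ⟨hdomR, .of_quotSMulTop hx (mul_right_injective₀ hx0)
      (hdepth.of_quotient_ring.congr (Submodule.quotEquivOfEq _ _ hspan))⟩

theorem hasDepthAtLeast_spanFinrank_maximalIdeal (R : Type*) [CommRing R] [IsRegularLocalRing R] :
    HasDepthAtLeast R R (maximalIdeal R).spanFinrank :=
  (isDomain_and_hasDepthAtLeast_of_spanFinrank_eq _ R rfl).2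

end RegularLocalRing

section Depth

open IsLocalRing RingTheory.Sequence CategoryTheory Abelian Limits
open scoped Pointwise

universe u

variable {R : Type u} [CommRing R] [IsLocalRing R] [IsNoetherianRing R]
  {M : Type u} [AddCommGroup M] [Module R M] [Module.Finite R M]

/-- Depth is detected by the vanishing of `Ext i (R ⧸ 𝔪) M`, and multiplication by `x` gives a long
exact sequence. -/
theorem HasDepthAtLeast.quotSMulTop {n : ℕ} (h : HasDepthAtLeast R M (n + 1)) {x : R}
    (hx : x ∈ maximalIdeal R) (hreg : IsSMulRegular M x) :
    HasDepthAtLeast R (QuotSMulTop x M) n := by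
  obtain ⟨rs, hlen, hmem, hrs⟩ := h
  have : Nontrivial M := hrs.nontrivial
  have : Nontrivial (QuotSMulTop x M) := nontrivial_quotSMulTop_of_mem_maximalIdeal M hx
  have smul_top_lt (L : Type u) [AddCommGroup L] [Module R L] [Module.Finite R L] [Nontrivial L] :
      maximalIdeal R • (⊤ : Submodule R L) < ⊤ :=
    Ne.lt_top' (Submodule.top_ne_ideal_smul_of_le_jacobson_annihilator (maximalIdeal_le_jacobson _))
  have hsupp : Module.support R (R ⧸ maximalIdeal R) =
      PrimeSpectrum.zeroLocus (maximalIdeal R : Set R) := by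
    rw [Module.support_eq_zeroLocus, Ideal.annihilator_quotient]
  have hext := ModuleCat.subsingleton_ext_of_exists_isRegular (maximalIdeal R)
    (ModuleCat.of R (R ⧸ maximalIdeal R)) hsupp.subset (ModuleCat.of R M) (smul_top_lt M) rs hmem
    hrs
  refine ModuleCat.exists_isRegular_of_exists_subsingleton_ext (maximalIdeal R) n
    (ModuleCat.of R (QuotSMulTop x M)) (smul_top_lt (QuotSMulTop x M))
    (ModuleCat.of R (R ⧸ maximalIdeal R)) hsupp fun i hi => ?_
  have hreg' : IsSMulRegular (ModuleCat.of R M) x := hreg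
  have hzero (j : ℕ) (hj : j < rs.length) :=
    AddCommGrpCat.isZero_of_iff_subsingleton.mpr (hext j hj)
  exact AddCommGrpCat.subsingleton_of_isZero <| ShortComplex.Exact.isZero_of_both_zeros
    ((Ext.covariant_sequence_exact₃' (ModuleCat.of R (R ⧸ maximalIdeal R))
      hreg'.smulShortComplex_shortExact) i (i + 1) rfl)
    ((hzero i (by omega)).eq_zero_of_src _) ((hzero (i + 1) (by omega)).eq_zero_of_tgt _)

/-- Otherwise Nakayama's lemma would kill the submodule of elements annihilated by `p`. -/
theorem exists_mem_torsionBySet_mk_ne_zero {x : R} (hx : x ∈ maximalIdeal R)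
    (hreg : IsSMulRegular M x) {p : Ideal R} (hp : Submodule.torsionBySet R M (p : Set R) ≠ ⊥) :
    ∃ y ∈ Submodule.torsionBySet R M (p : Set R),
      (Submodule.Quotient.mk y : QuotSMulTop x M) ≠ 0 := by
  by_contra! hcon
  refine hp (Submodule.eq_bot_of_le_smul_of_le_jacobson_bot (Ideal.span {x}) _
    (IsNoetherian.noetherian _) (fun a ha => ?_) ?_)
  · obtain ⟨b, -, rfl⟩ := (Submodule.mem_smul_pointwise_iff_exists _ _ _).1
      ((Submodule.Quotient.mk_eq_zero _).1 (hcon a ha))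
    refine Submodule.smul_mem_smul (Ideal.mem_span_singleton_self x)
      ((Submodule.mem_torsionBySet_iff _ _).2 fun r => hreg ?_)
    have hr := (Submodule.mem_torsionBySet_iff _ _).1 ha r
    rwa [smul_comm, ← smul_zero x] at hr
  · rwa [jacobson_eq_maximalIdeal _ bot_ne_top, Ideal.span_singleton_le_iff_mem]

theorem exists_mem_associatedPrimes_quotSMulTop_gt {x : R} (hx : x ∈ maximalIdeal R)
    (hreg : IsSMulRegular M x) {p : Ideal R} (hp : p ∈ associatedPrimes R M) :
    ∃ q ∈ associatedPrimes R (QuotSMulTop x M), p ≤ q ∧ x ∈ q ∧ x ∉ p := by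
  obtain ⟨hpp, z, hz⟩ := isAssociatedPrime_iff.1 hp
  have hpz (r : R) (hr : r ∈ p) : r • z = 0 := by
    rwa [hz, Submodule.mem_colon_singleton, Submodule.mem_bot] at hr
  have hz0 : z ≠ 0 := by
    rintro rfl
    exact hpp.ne_top (hz.trans (by simp))
  obtain ⟨y, hy, hy0⟩ := exists_mem_torsionBySet_mk_ne_zero hx hreg (p := p)
    fun h => hz0 ((Submodule.mem_bot R).1
      (h ▸ (Submodule.mem_torsionBySet_iff _ _).2 fun r => hpz r r.2))
  obtain ⟨q, hq, hle⟩ := exists_le_isAssociatedPrime_of_isNoetherianRing R _ hy0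
  refine ⟨q, hq, fun r hr => hle ?_, hle ?_, fun hxp => hz0 (hreg ?_)⟩
  · rw [Submodule.mem_colon_singleton, ← Submodule.Quotient.mk_smul,
      (Submodule.mem_torsionBySet_iff _ _).1 hy ⟨r, hr⟩]
    exact zero_mem _
  · rw [Submodule.mem_colon_singleton, ← Submodule.Quotient.mk_smul, Submodule.mem_bot,
      Submodule.Quotient.mk_eq_zero]
    exact Submodule.smul_mem_pointwise_smul _ _ _ trivial
  · exact (hpz x hxp).trans (smul_zero x).symm

theorem HasDepthAtLeast.le_ringKrullDim_quotient {n : ℕ} :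
    ∀ {M : Type u} [AddCommGroup M] [Module R M] [Module.Finite R M], HasDepthAtLeast R M n →
      ∀ p ∈ associatedPrimes R M, (n : WithBot ℕ∞) ≤ ringKrullDim (R ⧸ p) := by
  induction n with
  | zero =>
    intro M _ _ _ _ p hp
    have : Nontrivial (R ⧸ p) := Ideal.Quotient.nontrivial_iff.2 hp.isPrime.ne_top
    exact_mod_cast ringKrullDim_nonneg_of_nontrivial
  | succ n ih =>
    rintro M _ _ _ ⟨rs, hlen, hmem, hrs⟩ p hp
    obtain ⟨x, xs, rfl⟩ := List.exists_cons_of_length_eq_add_one hlen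
    obtain ⟨hx, hxs⟩ := List.forall_mem_cons.1 hmem
    obtain ⟨hreg, hrs⟩ := (isRegular_cons_iff M x xs).1 hrs
    obtain ⟨q, hq, hpq, hxq, hxp⟩ := exists_mem_associatedPrimes_quotSMulTop_gt hx hreg hp
    have : p.IsPrime := hp.isPrime
    calc ((n + 1 : ℕ) : WithBot ℕ∞) = n + 1 := Nat.cast_succ n
      _ ≤ ringKrullDim (R ⧸ q) + 1 := by
        gcongr
        exact ih ⟨xs, Nat.succ_injective hlen, hxs, hrs⟩ q hq
      _ ≤ ringKrullDim (R ⧸ p) := ringKrullDim_succ_le_of_surjective (Ideal.Quotient.factor hpq)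
        (Ideal.Quotient.factor_surjective hpq) (r := Ideal.Quotient.mk p x)
        (mem_nonZeroDivisors_of_ne_zero (by rwa [Ne, Ideal.Quotient.eq_zero_iff_mem]))
        (by rwa [Ideal.Quotient.factor_mk, Ideal.Quotient.eq_zero_iff_mem])

theorem supportDim_le_supportDim_quotient_ofList_add_length (xs : List R) :
    ∀ (M : Type u) [AddCommGroup M] [Module R M] [Module.Finite R M],
      (∀ x ∈ xs, x ∈ maximalIdeal R) → Module.supportDim R M ≤
        Module.supportDim R (M ⧸ Ideal.ofList xs • (⊤ : Submodule R M)) + xs.length := by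
  induction xs with
  | nil =>
    intro M _ _ _ _
    rw [List.length_nil, Nat.cast_zero, add_zero,
      Module.supportDim_eq_of_equiv (Submodule.quotEquivOfEqBot _ (by simp))]
  | cons x xs ih =>
    intro M _ _ _ hxs
    obtain ⟨hx, hxs⟩ := List.forall_mem_cons.1 hxs
    rw [Module.supportDim_eq_of_equiv (Submodule.quotOfListConsSMulTopEquivQuotSMulTopInner M x xs),
      List.length_cons, Nat.cast_succ, ← add_assoc]
    refine (Module.supportDim_le_supportDim_quotSMulTop_succ (M := M) hx).trans ?_
    gcongr
    exact ih (QuotSMulTop x M) hxs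

theorem HasDepthAtLeast.isSMulRegular {n : ℕ} (h : HasDepthAtLeast R M (n + 1)) {x : R}
    (hdim : Module.supportDim R (QuotSMulTop x M) ≤ n) : IsSMulRegular M x := by
  by_contra hreg
  obtain ⟨q, hq, hxq⟩ := Set.mem_iUnion₂.1
    ((biUnion_associatedPrimes_eq_compl_regular R M).ge hreg)
  have hann : Module.annihilator R (QuotSMulTop x M) ≤ q := by
    have := hq.isPrime
    have hmem : (⟨q, this⟩ : PrimeSpectrum R) ∈ Module.support R (QuotSMulTop x M) := by
      rw [Module.support_quotSMulTop, Module.support_eq_zeroLocus]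
      exact ⟨Submodule.annihilator_top (R := R) (M := M) ▸ hq.annihilator_le, by simpa using hxq⟩
    rwa [Module.support_eq_zeroLocus] at hmem
  have hle := calc ((n + 1 : ℕ) : WithBot ℕ∞) ≤ ringKrullDim (R ⧸ q) :=
        h.le_ringKrullDim_quotient q hq
    _ ≤ ringKrullDim (R ⧸ Module.annihilator R (QuotSMulTop x M)) :=
        ringKrullDim_le_of_surjective _ (Ideal.Quotient.factor_surjective hann)
    _ ≤ n := Module.supportDim_eq_ringKrullDim_quotient_annihilator R (QuotSMulTop x M) ▸ hdim
  exact n.not_succ_le_self (mod_cast hle)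

/-- A sequence that cuts the dimension down to the expected value is regular, so it lowers the depth
by no more than its length. -/
theorem HasDepthAtLeast.quotient_ofList {m : ℕ} (xs : List R) :
    ∀ {M : Type u} [AddCommGroup M] [Module R M] [Module.Finite R M],
      HasDepthAtLeast R M (m + xs.length) → (∀ x ∈ xs, x ∈ maximalIdeal R) →
      Module.supportDim R (M ⧸ Ideal.ofList xs • (⊤ : Submodule R M)) ≤ m →
      HasDepthAtLeast R (M ⧸ Ideal.ofList xs • (⊤ : Submodule R M)) m := by
  induction xs with
  | nil =>
    intro M _ _ _ h _ _
    exact h.congr (Submodule.quotEquivOfEqBot _ (by simp)).symm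
  | cons x xs ih =>
    intro M _ _ _ h hxs hdim
    obtain ⟨hx, hxs⟩ := List.forall_mem_cons.1 hxs
    let e := Submodule.quotOfListConsSMulTopEquivQuotSMulTopInner M x xs
    rw [Module.supportDim_eq_of_equiv e] at hdim
    have hreg : IsSMulRegular M x := h.isSMulRegular (n := m + xs.length) <|
      (supportDim_le_supportDim_quotient_ofList_add_length xs _ hxs).trans
        ((add_le_add_left hdim _).trans_eq (Nat.cast_add m _).symm)
    exact (ih (h.quotSMulTop hx hreg) hxs hdim).congr e.symm

end Depth

section Unmixed

open IsLocalRing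

theorem height_add_ringKrullDim_quotient_le {R : Type*} [CommRing R] (I : Ideal R) :
    I.height + ringKrullDim (R ⧸ I) ≤ ringKrullDim R := by
  rw [ringKrullDim_quotient]
  obtain hempty | hne := isEmpty_or_nonempty (PrimeSpectrum.zeroLocus (I : Set R))
  · rw [Order.krullDim_eq_bot, WithBot.add_bot]
    exact bot_le
  have : Nonempty (PrimeSpectrum R) := hne.map Subtype.val
  rw [Order.krullDim_eq_iSup_coheight_of_nonempty, ringKrullDim,
    Order.krullDim_eq_iSup_height_add_coheight_of_nonempty, ← WithBot.coe_add, WithBot.coe_le_coe,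
    ENat.add_iSup]
  refine iSup_le fun q => le_iSup_of_le (q : PrimeSpectrum R) (add_le_add ?_ ?_)
  · rw [← PrimeSpectrum.height_eq_orderHeight]
    exact Ideal.height_mono q.2
  · exact Order.coheight_le_coheight_apply_of_strictMono Subtype.val (fun _ _ h => h) q

universe u

theorem height_maximalIdeal_eq_length_of_mem_associatedPrimes {R : Type u} [CommRing R]
    [IsRegularLocalRing R] {xs : List R} (hht : xs.length ≤ (Ideal.ofList xs).height)
    (hass : maximalIdeal R ∈ associatedPrimes R (R ⧸ Ideal.ofList xs)) :
    (maximalIdeal R).height = xs.length := by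
  have hle : Ideal.ofList xs ≤ maximalIdeal R := by
    have := hass.annihilator_le
    rwa [Submodule.annihilator_top, Ideal.annihilator_quotient] at this
  have hdim := IsRegularLocalRing.spanFinrank_maximalIdeal (R := R)
  have hheight : (maximalIdeal R).height = (maximalIdeal R).spanFinrank := by
    rw [← maximalIdeal_height_eq_ringKrullDim] at hdim
    exact_mod_cast hdim.symm
  obtain ⟨m, hm⟩ : ∃ m, (maximalIdeal R).spanFinrank = m + xs.length :=
    Nat.exists_eq_add_of_le' (mod_cast hht.trans ((Ideal.height_mono hle).trans_eq hheight))
  have hquot : ringKrullDim (R ⧸ Ideal.ofList xs) ≤ m := by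
    have hadd : (xs.length : WithBot ℕ∞) + ringKrullDim (R ⧸ Ideal.ofList xs) ≤ xs.length + m :=
      calc
        _ ≤ (Ideal.ofList xs).height + ringKrullDim (R ⧸ Ideal.ofList xs) := by
          gcongr
          exact_mod_cast hht
        _ ≤ ringKrullDim R := height_add_ringKrullDim_quotient_le _
        _ = xs.length + m := by rw [← hdim, hm, Nat.cast_add, add_comm]
    exact (ENat.WithBot.add_le_add_natCast_left_iff).1 hadd
  let e : (R ⧸ Ideal.ofList xs • (⊤ : Submodule R R)) ≃ₗ[R] R ⧸ Ideal.ofList xs :=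
    Submodule.quotEquivOfEq _ _ (by rw [smul_eq_mul, Ideal.mul_top])
  have hdepth : HasDepthAtLeast R (R ⧸ Ideal.ofList xs) m :=
    (HasDepthAtLeast.quotient_ofList xs (hm ▸ hasDepthAtLeast_spanFinrank_maximalIdeal R)
      (fun x hx => hle (Ideal.subset_span hx)) (by
        rwa [Module.supportDim_eq_of_equiv e, Module.supportDim_quotient_eq_ringKrullDim])).congr e
  have hm0 : (m : WithBot ℕ∞) ≤ 0 :=
    (hdepth.le_ringKrullDim_quotient _ hass).trans_eq
      (ringKrullDim_eq_zero_of_field (ResidueField R))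
  obtain rfl : m = 0 := by simpa using hm0
  rw [hheight, hm, zero_add]

theorem mem_colon_singleton_mk_iff {R : Type*} [CommRing R] {I : Ideal R} {r y : R} :
    r ∈ (⊥ : Submodule R (R ⧸ I)).colon {Ideal.Quotient.mk I y} ↔ r * y ∈ I := by
  rw [Submodule.mem_colon_singleton, Submodule.mem_bot, Algebra.smul_def,
    Ideal.Quotient.algebraMap_eq, ← map_mul, Ideal.Quotient.eq_zero_iff_mem]

theorem maximalIdeal_mem_associatedPrimes_localization {R : Type u} [CommRing R]
    [IsNoetherianRing R] {I Q : Ideal R} [Q.IsPrime] (hQ : Q ∈ associatedPrimes R (R ⧸ I)) :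
    maximalIdeal (Localization.AtPrime Q) ∈ associatedPrimes (Localization.AtPrime Q)
      (Localization.AtPrime Q ⧸ I.map (algebraMap R (Localization.AtPrime Q))) := by
  obtain ⟨-, y, hy⟩ := isAssociatedPrime_iff.1 hQ
  obtain ⟨y, rfl⟩ := Ideal.Quotient.mk_surjective y
  have hy (r : R) : r ∈ Q ↔ r * y ∈ I := hy ▸ mem_colon_singleton_mk_iff
  refine isAssociatedPrime_iff.2 ⟨inferInstance, Ideal.Quotient.mk _ (algebraMap _ _ y), ?_⟩
  ext z
  obtain ⟨a, s, rfl⟩ := IsLocalization.exists_mk'_eq Q.primeCompl z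
  rw [IsLocalization.AtPrime.mk'_mem_maximal_iff _ Q, mem_colon_singleton_mk_iff,
    mul_comm, IsLocalization.mul_mk'_eq_mk'_of_mul,
    IsLocalization.mk'_mem_map_algebraMap_iff]
  refine ⟨fun ha => ⟨1, one_mem _, ?_⟩, fun ⟨t, ht, hta⟩ => ?_⟩
  · rw [one_mul, mul_comm]
    exact (hy a).1 ha
  · refine ((inferInstance : Q.IsPrime).mem_or_mem ((hy (t * a)).2 ?_)).resolve_left ht
    rwa [mul_assoc, mul_comm a]

/-- **Macaulay's unmixedness theorem**. -/
theorem height_eq_length_of_mem_associatedPrimes {R : Type u} [CommRing R] [IsRegularRing R]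
    {xs : List R} (hht : xs.length ≤ (Ideal.ofList xs).height) {Q : Ideal R}
    (hQ : Q ∈ associatedPrimes R (R ⧸ Ideal.ofList xs)) : Q.height = xs.length := by
  have : Q.IsPrime := hQ.isPrime
  have := IsRegularRing.isRegularLocalRing_localization Q
  let A := Localization.AtPrime Q
  have hA := height_maximalIdeal_eq_length_of_mem_associatedPrimes (R := A)
    (xs := xs.map (algebraMap R A)) (by
      rw [List.length_map, ← Ideal.map_ofList, ← IsLocalization.height_under Q.primeCompl]
      exact hht.trans (Ideal.height_mono Ideal.le_comap_map))
    (by rw [← Ideal.map_ofList]; exact maximalIdeal_mem_associatedPrimes_localization hQ)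
  rwa [List.length_map, ← IsLocalization.height_under Q.primeCompl,
    IsLocalization.AtPrime.under_maximalIdeal A Q] at hA

theorem mem_of_forall_associatedPrimes {R : Type u} [CommRing R] [IsNoetherianRing R]
    {I : Ideal R} {f : R} (h : ∀ Q ∈ associatedPrimes R (R ⧸ I), ∃ s ∉ Q, s * f ∈ I) : f ∈ I := by
  by_contra hf
  obtain ⟨Q, hQ, hle⟩ := exists_le_isAssociatedPrime_of_isNoetherianRing R (Ideal.Quotient.mk I f)
    (by rwa [Ne, Ideal.Quotient.eq_zero_iff_mem])
  obtain ⟨s, hs, hsf⟩ := h Q hQ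
  exact hs (hle (mem_colon_singleton_mk_iff.2 hsf))

end Unmixed

namespace Mumford

section Gradient

open MvPolynomial

variable {σ k K : Type*} [CommRing k] [CommRing K]

/-- The gradient of a polynomial in several variables, pushed forward by a ring homomorphism `φ`:
for an evaluation `φ`, it is the gradient at a point. -/
noncomputable def polyGrad (φ : MvPolynomial σ k →+* K) : MvPolynomial σ k →+ (σ → K) where
  toFun F c := φ (pderiv c F)
  map_zero' := by ext; simp
  map_add' F G := by ext; simp

variable {φ : MvPolynomial σ k →+* K}

theorem polyGrad_mul (F G : MvPolynomial σ k) :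
    polyGrad φ (F * G) = φ F • polyGrad φ G + φ G • polyGrad φ F := by
  ext c
  simp [polyGrad, Derivation.leibniz]

theorem polyGrad_X [DecidableEq σ] (c : σ) : polyGrad φ (X c) = Pi.single c 1 := by
  ext d
  obtain rfl | h := eq_or_ne c d
  · simp [polyGrad]
  · simp [polyGrad, pderiv_X_of_ne h, Pi.single_eq_of_ne' h]

theorem polyGrad_C (a : k) : polyGrad φ (C a) = 0 := by
  ext d
  simp [polyGrad]

theorem polyGrad_sub_C (F : MvPolynomial σ k) (a : k) : polyGrad φ (F - C a) = polyGrad φ F := by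
  rw [map_sub, polyGrad_C, sub_zero]

theorem polyGrad_mem_span_of_mem_span {Z : Set (MvPolynomial σ k)} (hZ : ∀ z ∈ Z, φ z = 0)
    {F : MvPolynomial σ k} (hF : F ∈ Ideal.span Z) :
    polyGrad φ F ∈ Submodule.span K (polyGrad φ '' Z) := by
  induction hF using Submodule.span_induction with
  | mem x hx => exact Submodule.subset_span ⟨x, hx, rfl⟩
  | zero => exact map_zero (polyGrad φ) ▸ zero_mem _
  | add x y _ _ hx hy => exact map_add (polyGrad φ) x y ▸ add_mem hx hy
  | smul a x hx h =>
    have hx0 : φ x = 0 := (Ideal.span_le (I := RingHom.ker φ)).2 hZ hx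
    rw [smul_eq_mul, polyGrad_mul, hx0, zero_smul, add_zero]
    exact Submodule.smul_mem _ _ h

theorem polyGrad_mem_span_of_mul_mem_span {K : Type*} [Field K] {φ : MvPolynomial σ k →+* K}
    {Z : Set (MvPolynomial σ k)} (hZ : ∀ z ∈ Z, φ z = 0) {F s : MvPolynomial σ k} (hF : φ F = 0)
    (hs : φ s ≠ 0) (hsF : s * F ∈ Ideal.span Z) :
    polyGrad φ F ∈ Submodule.span K (polyGrad φ '' Z) := by
  have h := polyGrad_mem_span_of_mem_span hZ hsF
  rwa [polyGrad_mul, hF, zero_smul, add_zero, Submodule.smul_mem_iff _ hs] at h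

end Gradient

section LocalGenerators

open IsLocalRing MvPolynomial Matrix

theorem exists_generators_localization {R : Type*} [CommRing R] [IsNoetherianRing R] (P : Ideal R)
    [P.IsPrime] :
    ∃ z : Fin (maximalIdeal (Localization.AtPrime P)).spanFinrank → R, (∀ i, z i ∈ P) ∧
      ∀ F ∈ P, ∃ s ∉ P, s * F ∈ Ideal.span (Set.range z) := by
  let A := Localization.AtPrime P
  obtain ⟨y, hy⟩ : ∃ y : Fin (maximalIdeal A).spanFinrank → A,
      Ideal.span (Set.range y) = maximalIdeal A := by
    obtain ⟨s, hcard, hs⟩ :=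
      (IsNoetherian.noetherian (maximalIdeal A)).exists_span_finset_card_eq_spanFinrank
    let e := (s.equivFinOfCardEq hcard).symm
    exact ⟨Subtype.val ∘ e, by rwa [EquivLike.range_comp, Subtype.range_coe]⟩
  choose z t hzt using fun i => IsLocalization.exists_mk'_eq P.primeCompl (y i)
  refine ⟨z, fun i => ?_, fun F hF => ?_⟩
  · have : y i ∈ maximalIdeal A := hy ▸ Submodule.subset_span ⟨i, rfl⟩
    rwa [← hzt, IsLocalization.AtPrime.mk'_mem_maximal_iff A P] at this
  · have hle : maximalIdeal A ≤ (Ideal.span (Set.range z)).map (algebraMap R A) := by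
      refine hy.symm.le.trans (Submodule.span_le.2 ?_)
      rintro _ ⟨i, rfl⟩
      rw [SetLike.mem_coe, ← hzt, IsLocalization.mk'_eq_mul_mk'_one]
      exact Ideal.mul_mem_right _ _ (Ideal.mem_map_of_mem _ (Ideal.subset_span ⟨i, rfl⟩))
    obtain ⟨s, hs, hsF⟩ := (IsLocalization.algebraMap_mem_map_algebraMap_iff P.primeCompl A _ _).1
      (hle ((IsLocalization.AtPrime.to_map_mem_maximal_iff A P F).2 hF))
    exact ⟨s, hs, hsF⟩

theorem maximalIdeal_localization_le_map {R : Type*} [CommRing R] {P J : Ideal R} [P.IsPrime]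
    (h : ∀ F ∈ P, ∃ s ∉ P, s * F ∈ J) :
    maximalIdeal (Localization.AtPrime P) ≤ J.map (algebraMap R (Localization.AtPrime P)) := by
  rw [← Localization.AtPrime.map_eq_maximalIdeal, Ideal.map_le_iff_le_comap]
  intro F hF
  obtain ⟨s, hs, hsF⟩ := h F hF
  exact (IsLocalization.algebraMap_mem_map_algebraMap_iff P.primeCompl _ _ _).2 ⟨s, hs, hsF⟩

theorem det_mul_mem_span_mulVec {R ι : Type*} [CommRing R] [Fintype ι] [DecidableEq ι]
    (a : Matrix ι ι R) (y : ι → R) (j : ι) : a.det * y j ∈ Ideal.span (Set.range (a *ᵥ y)) := by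
  have hadj : a.adjugate *ᵥ a *ᵥ y = a.det • y := by
    rw [mulVec_mulVec, adjugate_mul, smul_mulVec, one_mulVec]
  have hj : a.det * y j = ∑ i, a.adjugate j i * (a *ᵥ y) i := (congrFun hadj j).symm
  rw [hj]
  exact sum_mem fun i _ => Ideal.mul_mem_left _ _ (Ideal.subset_span ⟨i, rfl⟩)

variable {σ k K : Type*} [Field k] [Field K] {φ : MvPolynomial σ k →+* K}

theorem map_det_ne_zero_of_linearIndependent {ι : Type*} [Fintype ι] [DecidableEq ι]
    {s y z : ι → MvPolynomial σ k} {a : Matrix ι ι (MvPolynomial σ k)}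
    (hy : ∀ i, φ (y i) = 0) (hz : ∀ i, φ (z i) = 0) (hs : ∀ i, φ (s i) ≠ 0)
    (ha : a *ᵥ y = fun i => s i * z i) (hli : LinearIndependent K fun i => polyGrad φ (z i)) :
    φ a.det ≠ 0 := by
  have hgrad (i : ι) : φ (s i) • polyGrad φ (z i) = ∑ j, φ (a i j) • polyGrad φ (y j) := by
    simpa [mulVec, dotProduct, polyGrad_mul, hz, hy]
      using congrArg (polyGrad φ) (congrFun ha i).symm
  intro h0
  rw [RingHom.map_det] at h0
  obtain ⟨v, hv0, hv⟩ := Matrix.exists_vecMul_eq_zero_iff.2 h0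
  refine hv0 (funext fun i => ?_)
  have hsum : ∑ i, (v i * φ (s i)) • polyGrad φ (z i) = 0 := by
    simp_rw [mul_smul, hgrad, Finset.smul_sum, smul_smul]
    rw [Finset.sum_comm]
    refine Finset.sum_eq_zero fun j _ => ?_
    rw [← Finset.sum_smul, show ∑ i, v i * φ (a i j) = 0 from congrFun hv j, zero_smul]
  exact (mul_eq_zero.1 (Fintype.linearIndependent_iff.1 hli _ hsum i)).resolve_right (hs i)

variable [Finite σ]

theorem spanFinrank_maximalIdeal_localization_eq_height (P : Ideal (MvPolynomial σ k))
    [P.IsPrime] : ((maximalIdeal (Localization.AtPrime P)).spanFinrank : ℕ∞) = P.height := by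
  have := IsRegularRing.isRegularLocalRing_localization P
  have h := IsRegularLocalRing.spanFinrank_maximalIdeal (R := Localization.AtPrime P)
  rw [IsLocalization.AtPrime.ringKrullDim_eq_height P] at h
  exact_mod_cast h

theorem finrank_span_polyGrad_le_height :
    (Module.finrank K (Submodule.span K (polyGrad φ '' (RingHom.ker φ : Set _))) : ℕ∞) ≤
      (RingHom.ker φ).height := by
  have := RingHom.ker_isPrime φ
  obtain ⟨z, hz, hgen⟩ := exists_generators_localization (RingHom.ker φ)
  have hle : Submodule.span K (polyGrad φ '' (RingHom.ker φ : Set _)) ≤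
      Submodule.span K (Set.range (polyGrad φ ∘ z)) := by
    rw [Submodule.span_le, Set.range_comp]
    rintro _ ⟨F, hF, rfl⟩
    obtain ⟨s, hs, hsF⟩ := hgen F hF
    exact polyGrad_mem_span_of_mul_mem_span (Set.forall_mem_range.2 hz) hF hs hsF
  rw [← spanFinrank_maximalIdeal_localization_eq_height, Nat.cast_le]
  simpa only [Fintype.card_fin] using
    (Submodule.finrank_mono hle).trans (finrank_range_le_card (R := K) (polyGrad φ ∘ z))

/-- If `s_i z_i = ∑ j, a_ij y_j` with `y` local generators, then `det a` is a unit locally because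
the gradients of the `z_i` are independent, so the `y_j` lie in the ideal of the `z_i` locally. -/
theorem exists_mul_mem_span_of_linearIndependent {ι : Type*} [Fintype ι]
    {z : ι → MvPolynomial σ k} (hz : ∀ i, φ (z i) = 0)
    (hli : LinearIndependent K fun i => polyGrad φ (z i))
    (hcard : (RingHom.ker φ).height = Fintype.card ι) {F : MvPolynomial σ k} (hF : φ F = 0) :
    ∃ s, φ s ≠ 0 ∧ s * F ∈ Ideal.span (Set.range z) := by
  classical
  have hP := RingHom.ker_isPrime φ
  obtain ⟨y, hy, hgen⟩ : ∃ y : ι → MvPolynomial σ k, (∀ i, φ (y i) = 0) ∧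
      ∀ F, φ F = 0 → ∃ s, φ s ≠ 0 ∧ s * F ∈ Ideal.span (Set.range y) := by
    obtain ⟨y, hy, hgen⟩ := exists_generators_localization (RingHom.ker φ)
    rw [← spanFinrank_maximalIdeal_localization_eq_height, Nat.cast_inj] at hcard
    let e : ι ≃ Fin _ := Fintype.equivFinOfCardEq hcard.symm
    exact ⟨y ∘ e, fun i => hy _, by rwa [EquivLike.range_comp]⟩
  choose s hs hsz using fun i => hgen (z i) (hz i)
  choose b hb using fun i => Ideal.mem_span_range_iff_exists_fun.1 (hsz i)
  have ha : Matrix.of b *ᵥ y = fun i => s i * z i := funext hb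
  have hspan : Ideal.span (Set.range (Matrix.of b *ᵥ y)) ≤ Ideal.span (Set.range z) := by
    rw [ha, Ideal.span_le]
    rintro _ ⟨i, rfl⟩
    exact Ideal.mul_mem_left _ _ (Ideal.subset_span ⟨i, rfl⟩)
  obtain ⟨t, ht, htF⟩ := hgen F hF
  obtain ⟨c, hc⟩ := Ideal.mem_span_range_iff_exists_fun.1 htF
  have hdet : φ (Matrix.of b).det ≠ 0 := map_det_ne_zero_of_linearIndependent hy hz hs ha hli
  refine ⟨(Matrix.of b).det * t, by simpa only [map_mul] using mul_ne_zero hdet ht, ?_⟩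
  rw [mul_assoc, ← hc, Finset.mul_sum]
  exact sum_mem fun j _ => by
    rw [mul_left_comm]
    exact Ideal.mul_mem_left _ _ (hspan (det_mul_mem_span_mulVec _ y j))

end LocalGenerators

section TangentSpace

open Matrix

variable {σ k K : Type*} [Fintype σ] [Field k] [Field K] {φ : MvPolynomial σ k →+* K}

/-- The Zariski tangent space, at the `K`-valued point `φ`, of the closure of that point. -/
noncomputable def tangentSpace (φ : MvPolynomial σ k →+* K) : Submodule K (σ → K) where
  carrier := {t | ∀ F, φ F = 0 → t ⬝ᵥ polyGrad φ F = 0}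
  zero_mem' F _ := zero_dotProduct _
  add_mem' hs ht F hF := by rw [add_dotProduct, hs F hF, ht F hF, add_zero]
  smul_mem' c t ht F hF := by rw [smul_dotProduct, ht F hF, smul_zero]

theorem card_le_height_ker_add_finrank_tangentSpace :
    (Fintype.card σ : ℕ∞) ≤ (RingHom.ker φ).height + Module.finrank K (tangentSpace φ) := by
  classical
  let W := Submodule.span K (polyGrad φ '' (RingHom.ker φ : Set _))
  have hmap : W.dualAnnihilator ≤
      (tangentSpace φ).map (dotProductEquiv K σ : (σ → K) →ₗ[K] Module.Dual K (σ → K)) := by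
    intro f hf
    obtain ⟨t, rfl⟩ := (dotProductEquiv K σ).surjective f
    exact ⟨t, fun F hF => (W.mem_dualAnnihilator _).1 hf _
      (Submodule.subset_span (Set.mem_image_of_mem _ hF)), rfl⟩
  have hW := Subspace.finrank_add_finrank_dualAnnihilator_eq W
  rw [Module.finrank_fintype_fun_eq_card] at hW
  calc (Fintype.card σ : ℕ∞)
      = Module.finrank K W + Module.finrank K W.dualAnnihilator := by exact_mod_cast hW.symm
    _ ≤ (RingHom.ker φ).height + Module.finrank K (tangentSpace φ) :=
        add_le_add finrank_span_polyGrad_le_height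
          (Nat.cast_le.2 ((Submodule.finrank_mono hmap).trans (Submodule.finrank_map_le _ _)))

end TangentSpace

section Variation

open Polynomial Matrix

variable {σ k K : Type*} [Fintype σ] [CommRing k] [CommRing K] (φ : MvPolynomial σ k →+* K)
  (t : σ → K)

/-- The derivative, along the tangent vector `t` at `φ`, of a polynomial in one variable whose
coefficients are functions of the point. -/
noncomputable def variation : (MvPolynomial σ k)[X] →+ K[X] where
  toFun p := p.sum fun i F => monomial i (t ⬝ᵥ polyGrad φ F)
  map_zero' := sum_zero_index _
  map_add' p q := sum_add_index p q _ (fun _ => by simp) fun _ _ _ => by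
    rw [map_add, dotProduct_add, map_add]

theorem variation_monomial (i : ℕ) (F : MvPolynomial σ k) :
    variation φ t (monomial i F) = monomial i (t ⬝ᵥ polyGrad φ F) :=
  sum_monomial_index F (fun i F => monomial i (t ⬝ᵥ polyGrad φ F))
    (by rw [map_zero, dotProduct_zero, map_zero])

theorem coeff_variation (p : (MvPolynomial σ k)[X]) (j : ℕ) :
    (variation φ t p).coeff j = t ⬝ᵥ polyGrad φ (p.coeff j) := by
  induction p using Polynomial.induction_on' with
  | add p q hp hq => rw [map_add, coeff_add, coeff_add, hp, hq, map_add, dotProduct_add]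
  | monomial i F =>
    rw [variation_monomial, coeff_monomial, coeff_monomial]
    split_ifs
    · rfl
    · rw [map_zero, dotProduct_zero]

theorem variation_mul (p q : (MvPolynomial σ k)[X]) :
    variation φ t (p * q) = p.map φ * variation φ t q + q.map φ * variation φ t p := by
  ext j
  rw [mul_comm (q.map φ)]
  simp only [coeff_variation, coeff_add, coeff_mul, coeff_map, map_sum, dotProduct_sum,
    polyGrad_mul, dotProduct_add, dotProduct_smul, smul_eq_mul, Finset.sum_add_distrib]
  exact congrArg _ (Finset.sum_congr rfl fun _ _ => mul_comm _ _)

theorem variation_map_C (d : k[X]) : variation φ t (d.map MvPolynomial.C) = 0 := by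
  ext j
  rw [coeff_variation, coeff_map, polyGrad_C, dotProduct_zero, coeff_zero]

end Variation

section Syzygies

open Polynomial

theorem mul_mem_degreeLT {R : Type*} [Semiring R] {p q : R[X]} {m n : ℕ} (hp : p ∈ degreeLT R m)
    (hq : q ∈ degreeLT R (n + 1)) : p * q ∈ degreeLT R (m + n) := by
  rw [mem_degreeLT] at hp ⊢
  rw [degreeLT_succ_eq_degreeLE, mem_degreeLE] at hq
  obtain rfl | hq0 := eq_or_ne q 0
  · rw [mul_zero, degree_zero]
    exact WithBot.bot_lt_coe _
  · rw [Nat.cast_add]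
    exact (degree_mul_le p q).trans_lt
      (WithBot.add_lt_add_of_lt_of_le (degree_eq_bot.not.2 hq0) hp hq)

theorem monic_mul_mem_degreeLT_iff {R : Type*} [CommSemiring R] {D p : R[X]} (hD : D.Monic)
    {n : ℕ} : D * p ∈ degreeLT R (D.natDegree + n) ↔ p ∈ degreeLT R n := by
  nontriviality R
  rw [mem_degreeLT, mem_degreeLT, mul_comm, hD.degree_mul, degree_eq_natDegree hD.ne_zero,
    Nat.cast_add, add_comm]
  exact WithBot.add_lt_add_iff_left (WithBot.coe_ne_bot (a := D.natDegree))

variable {R : Type*} [CommRing R]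

/-- Triples `(a, b, c)` of polynomials with the degree bounds of variations of `(u, v, w)`. -/
noncomputable def degreeLTTriple (R : Type*) [CommRing R] (n : ℕ) :
    Submodule R (R[X] × R[X] × R[X]) :=
  (degreeLT R n).prod ((degreeLT R n).prod (degreeLT R (n + 1)))

theorem mem_degreeLTTriple {n : ℕ} {x : R[X] × R[X] × R[X]} :
    x ∈ degreeLTTriple R n ↔
      x.1 ∈ degreeLT R n ∧ x.2.1 ∈ degreeLT R n ∧ x.2.2 ∈ degreeLT R (n + 1) := Iff.rfl

/-- The polynomials `(δu, δv, δw)` whose coefficients are the components of a tangent vector. -/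
noncomputable def tangentTriple (n : ℕ) : (Coord n → R) →ₗ[R] R[X] × R[X] × R[X] :=
  let ofCoeffs (m : ℕ) : (Fin m → R) →ₗ[R] R[X] :=
    (degreeLT R m).subtype ∘ₗ (degreeLTEquiv R m).symm
  (ofCoeffs n ∘ₗ LinearMap.funLeft R R Sum.inl).prod
    ((ofCoeffs n ∘ₗ LinearMap.funLeft R R (Sum.inr ∘ Sum.inl)).prod
      (ofCoeffs (n + 1) ∘ₗ LinearMap.funLeft R R (Sum.inr ∘ Sum.inr)))

theorem tangentTriple_apply {n : ℕ} (t : Coord n → R) :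
    tangentTriple n t = (∑ i : Fin n, monomial i (t (.inl i)),
      ∑ i : Fin n, monomial i (t (.inr (.inl i))),
      ∑ i : Fin (n + 1), monomial i (t (.inr (.inr i)))) := rfl

theorem tangentTriple_mem {n : ℕ} (t : Coord n → R) : tangentTriple n t ∈ degreeLTTriple R n :=
  ⟨Subtype.property _, Subtype.property _, Subtype.property _⟩

theorem tangentTriple_injective (n : ℕ) :
    Function.Injective (tangentTriple n : (Coord n → R) →ₗ[R] _) := by
  intro s t hst
  have hinj {m : ℕ} {a b : Fin m → R}
      (h : ((degreeLTEquiv R m).symm a : R[X]) = (degreeLTEquiv R m).symm b) : a = b :=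
    (degreeLTEquiv R m).symm.injective (Subtype.ext h)
  obtain ⟨hu, hvw⟩ := Prod.ext_iff.1 hst
  obtain ⟨hv, hw⟩ := Prod.ext_iff.1 hvw
  ext (i | i | i)
  exacts [congrFun (hinj hu) i, congrFun (hinj hv) i, congrFun (hinj hw) i]

theorem tangentTriple_eq {n : ℕ} {t : Coord n → R} {x : R[X] × R[X] × R[X]}
    (hx : x ∈ degreeLTTriple R n) (hu : ∀ i, t (.inl i) = x.1.coeff i)
    (hv : ∀ i, t (.inr (.inl i)) = x.2.1.coeff i) (hw : ∀ i, t (.inr (.inr i)) = x.2.2.coeff i) :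
    tangentTriple n t = x := by
  have hsum {m : ℕ} {p : R[X]} (hp : p ∈ degreeLT R m) :
      ∑ i : Fin m, monomial i (p.coeff i) = p :=
    congrArg Subtype.val ((degreeLTEquiv R m).symm_apply_apply ⟨p, hp⟩)
  simp only [tangentTriple_apply, hu, hv, hw]
  exact Prod.ext (hsum hx.1) (Prod.ext (hsum hx.2.1) (hsum hx.2.2))

theorem range_tangentTriple (n : ℕ) : LinearMap.range (tangentTriple n) = degreeLTTriple R n := by
  refine le_antisymm ?_ fun ⟨a, b, c⟩ hx => ?_
  · rintro _ ⟨t, rfl⟩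
    exact tangentTriple_mem t
  · exact ⟨Sum.elim (fun i => a.coeff i) (Sum.elim (fun i => b.coeff i) (fun i => c.coeff i)),
      tangentTriple_eq hx (fun _ => rfl) (fun _ => rfl) (fun _ => rfl)⟩

/-- The differential `(a, b, c) ↦ w a + 2 v b + u c` of `(u, v, w) ↦ v² + u w`. -/
noncomputable def momentDeriv (u v w : R[X]) : R[X] × R[X] × R[X] →ₗ[R] R[X] :=
  (LinearMap.mulLeft R w).coprod
    ((LinearMap.mulLeft R (2 * v)).coprod (LinearMap.mulLeft R u))

theorem momentDeriv_apply (u v w : R[X]) (x : R[X] × R[X] × R[X]) :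
    momentDeriv u v w x = w * x.1 + (2 * v * x.2.1 + u * x.2.2) := rfl

theorem momentDeriv_mem_degreeLT {n : ℕ} {u v w : R[X]} (hu : u ∈ degreeLT R (n + 1))
    (hv : v ∈ degreeLT R (n + 1)) (hw : w ∈ degreeLT R (n + 2)) {x : R[X] × R[X] × R[X]}
    (hx : x ∈ degreeLTTriple R n) : momentDeriv u v w x ∈ degreeLT R (2 * n + 1) := by
  obtain ⟨ha, hb, hc⟩ := hx
  have hn : n + (n + 1) = 2 * n + 1 := by ring
  rw [momentDeriv_apply, mul_comm w, mul_assoc, mul_comm v, mul_comm u, ← hn]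
  refine add_mem (mul_mem_degreeLT ha hw) (add_mem ?_ ?_)
  · rw [← map_ofNat C 2, ← smul_eq_C_mul]
    exact Submodule.smul_mem _ _ (degreeLT_mono (by lia) (mul_mem_degreeLT hb hv))
  · rw [← add_assoc, add_right_comm]
    exact mul_mem_degreeLT hc hu

variable {K : Type*} [Field K]

theorem finrank_degreeLTTriple (n : ℕ) : Module.finrank K (degreeLTTriple K n) = 3 * n + 1 := by
  rw [← range_tangentTriple, LinearMap.finrank_range_of_inj (tangentTriple_injective n),
    Module.finrank_fintype_fun_eq_card]
  simp only [Fintype.card_sum, Fintype.card_fin]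
  ring

instance finite_degreeLTTriple (n : ℕ) : Module.Finite K (degreeLTTriple K n) :=
  range_tangentTriple (R := K) n ▸ Module.Finite.range _

theorem exists_momentDeriv_eq (h2 : (2 : K) ≠ 0) {n : ℕ} {u v w : K[X]} (hu : u.Monic)
    (hun : u.natDegree = n) (hv : v ∈ degreeLT K n) (hw : w ∈ degreeLT K (n + 2))
    (hspan : Ideal.span {u, v, w} = ⊤) {q : K[X]} (hq : q ∈ degreeLT K (2 * n + 1)) :
    ∃ x ∈ degreeLTTriple K n, momentDeriv u v w x = q := by
  obtain ⟨α, β, γ, hbezout⟩ := Submodule.mem_span_triple.1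
    ((Ideal.eq_top_iff_one (Ideal.span {u, v, w})).1 hspan)
  simp only [smul_eq_mul] at hbezout
  have hmod (p : K[X]) : p %ₘ u ∈ degreeLT K n := by
    rw [mem_degreeLT, ← hun, ← degree_eq_natDegree hu.ne_zero]
    exact degree_modByMonic_lt p hu
  have hdiv (p : K[X]) : p %ₘ u + u * (p /ₘ u) = p := modByMonic_add_div p u
  let a := (γ * q) %ₘ u
  let b := (β * q) %ₘ u
  let c := α * q + w * ((γ * q) /ₘ u) + v * ((β * q) /ₘ u)
  have huc : u * c = q - a * w - b * v := by
    linear_combination q * hbezout + w * hdiv (γ * q) + v * hdiv (β * q)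
  have hc : c ∈ degreeLT K (n + 1) := by
    rw [← monic_mul_mem_degreeLT_iff hu, hun, huc, show n + (n + 1) = 2 * n + 1 by ring]
    refine sub_mem (sub_mem hq ?_) ?_
    · rw [two_mul, add_assoc]
      exact mul_mem_degreeLT (hmod _) hw
    · exact degreeLT_mono (by lia)
        (mul_mem_degreeLT (hmod _) (degreeLT_mono (Nat.le_add_right n 1) hv))
  refine ⟨(a, (2⁻¹ : K) • b, c), ⟨hmod _, Submodule.smul_mem _ _ (hmod _), hc⟩, ?_⟩
  have htwo : 2 * C (2⁻¹ : K) = 1 := by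
    rw [← map_ofNat C 2, ← C_mul, mul_inv_cancel₀ h2, C_1]
  rw [momentDeriv_apply, smul_eq_C_mul]
  linear_combination v * b * htwo + huc

theorem finrank_degreeLTTriple_inf_ker_momentDeriv_le (h2 : (2 : K) ≠ 0) {n : ℕ} {u v w : K[X]}
    (hu : u.Monic) (hun : u.natDegree = n) (hv : v ∈ degreeLT K n) (hw : w ∈ degreeLT K (n + 2))
    (hspan : Ideal.span {u, v, w} = ⊤) :
    Module.finrank K ↥(degreeLTTriple K n ⊓ LinearMap.ker (momentDeriv u v w)) ≤ n := by
  let f := (momentDeriv u v w).domRestrict (degreeLTTriple K n)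
  have hrange : 2 * n + 1 ≤ Module.finrank K (LinearMap.range f) := by
    rw [← Module.finrank_fin_fun K (n := 2 * n + 1),
      ← (degreeLTEquiv K (2 * n + 1)).finrank_eq]
    refine Submodule.finrank_mono fun q hq => ?_
    obtain ⟨x, hx, rfl⟩ := exists_momentDeriv_eq h2 hu hun hv hw hspan hq
    exact ⟨⟨x, hx⟩, rfl⟩
  have hsum := f.finrank_range_add_finrank_ker
  rw [finrank_degreeLTTriple, ← Submodule.finrank_map_subtype_eq, LinearMap.ker_domRestrict,
    Submodule.map_comap_subtype] at hsum
  lia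

theorem exists_smul_eq_of_momentDeriv_eq_zero {n : ℕ} {D u v w : K[X]} (hD : D.Monic)
    {x : K[X] × K[X] × K[X]} (hx : x ∈ degreeLTTriple K (D.natDegree + n)) (h1 : D ∣ x.1)
    (h2 : D ∣ x.2.1) (h3 : D ∣ x.2.2) (hx0 : momentDeriv (D * u) (D * v) (D * w) x = 0) :
    ∃ y ∈ degreeLTTriple K n ⊓ LinearMap.ker (momentDeriv u v w), D • y = x := by
  obtain ⟨_, _, _⟩ := x
  obtain ⟨⟨a, rfl⟩, ⟨b, rfl⟩, ⟨c, rfl⟩⟩ := And.intro h1 (And.intro h2 h3)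
  simp only [mem_degreeLTTriple, add_assoc, monic_mul_mem_degreeLT_iff hD] at hx
  refine ⟨(a, b, c), ⟨hx, LinearMap.mem_ker.2 ?_⟩, rfl⟩
  refine mul_left_cancel₀ (mul_ne_zero hD.ne_zero hD.ne_zero) ?_
  rw [momentDeriv_apply] at hx0 ⊢
  linear_combination hx0

theorem exists_monic_common_factor {U V W : K[X]} (hU : U ≠ 0) :
    ∃ D u v w : K[X], D.Monic ∧ U = D * u ∧ V = D * v ∧ W = D * w ∧
      Ideal.span {u, v, w} = ⊤ ∧ Ideal.span {U, V, W} = Ideal.span {D} := by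
  classical
  obtain ⟨e, he⟩ := (IsPrincipalIdealRing.principal (Ideal.span {U, V, W})).principal
  have hspan : Ideal.span {U, V, W} = Ideal.span {normalize e} := by
    rw [he, ← Ideal.span, Ideal.span_singleton_eq_span_singleton]
    exact (normalize_associated e).symm
  have hdvd {p : K[X]} (hp : p ∈ ({U, V, W} : Set K[X])) : normalize e ∣ p :=
    Ideal.mem_span_singleton.1 (hspan ▸ Ideal.subset_span hp)
  obtain ⟨⟨u, rfl⟩, ⟨v, rfl⟩, ⟨w, rfl⟩⟩ := And.intro (hdvd (p := U) (by simp))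
    (And.intro (hdvd (p := V) (by simp)) (hdvd (p := W) (by simp)))
  have hne : normalize e ≠ 0 := left_ne_zero_of_mul hU
  refine ⟨normalize e, u, v, w, monic_normalize (normalize_eq_zero.not.1 hne), rfl, rfl, rfl, ?_,
    hspan⟩
  obtain ⟨α, β, γ, h⟩ := Submodule.mem_span_triple.1 (hspan ▸ Ideal.mem_span_singleton_self _ :
    normalize e ∈ Ideal.span {normalize e * u, normalize e * v, normalize e * w})
  refine (Ideal.eq_top_iff_one _).2 (Submodule.mem_span_triple.2 ⟨α, β, γ, ?_⟩)
  simp only [smul_eq_mul] at h ⊢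
  exact mul_left_cancel₀ hne (by linear_combination h)

theorem exists_monic_map_eq_of_dvd {k : Type*} [Field k] [IsAlgClosed k] {f : k →+* K} {h : k[X]}
    (hh : h.Monic) {e : K[X]} (he : e.Monic) (hdvd : e ∣ h.map f) :
    ∃ d : k[X], d.Monic ∧ d.map f = e := by
  have hne : h.map f ≠ 0 := (hh.map f).ne_zero
  have hlift : e ∈ lifts f := by
    refine (((IsAlgClosed.splits h).map f).of_dvd hne hdvd).mem_lift_of_roots_mem_range he f
      fun x hx => ?_
    have hroot := Multiset.mem_of_le (roots.le_of_dvd hne hdvd) hx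
    rw [(IsAlgClosed.splits h).roots_map] at hroot
    obtain ⟨y, -, rfl⟩ := Multiset.mem_map.1 hroot
    exact ⟨y, rfl⟩
  obtain ⟨d, hd, -, hmonic⟩ := lifts_and_natDegree_eq_and_monic hlift he
  exact ⟨d, hmonic, hd⟩

end Syzygies

section Entries

open Polynomial

variable {R : Type} [CommRing R] {g : ℕ} (a : Coord g → R)

theorem uPoly_eq : uPoly a = X ^ g + (tangentTriple g a).1 := by
  simp only [uPoly, tangentTriple_apply, C_mul_X_pow_eq_monomial]

theorem vPoly_eq : vPoly a = (tangentTriple g a).2.1 := by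
  simp only [vPoly, tangentTriple_apply, C_mul_X_pow_eq_monomial]

theorem wPoly_eq : wPoly a = X ^ (g + 1) + (tangentTriple g a).2.2 := by
  simp only [wPoly, tangentTriple_apply, C_mul_X_pow_eq_monomial]

theorem momentMap_eq : momentMap a = uPoly a * wPoly a + vPoly a ^ 2 := by
  simp only [momentMap, polyMatrix, Matrix.det_fin_two_of]
  ring

section Map

variable {S : Type} [CommRing S] (f : R →+* S)

theorem map_uPoly : (uPoly a).map f = uPoly (f ∘ a) := by
  simp [uPoly, Polynomial.map_sum]

theorem map_vPoly : (vPoly a).map f = vPoly (f ∘ a) := by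
  simp [vPoly, Polynomial.map_sum]

theorem map_wPoly : (wPoly a).map f = wPoly (f ∘ a) := by
  simp [wPoly, Polynomial.map_sum]

theorem map_momentMap : (momentMap a).map f = momentMap (f ∘ a) := by
  simp only [momentMap_eq, Polynomial.map_add, Polynomial.map_mul, Polynomial.map_pow, map_uPoly,
    map_vPoly, map_wPoly]

end Map

theorem vPoly_mem_degreeLT : vPoly a ∈ degreeLT R g :=
  vPoly_eq a ▸ (tangentTriple_mem a).2.1

theorem uPoly_mem_degreeLT : uPoly a ∈ degreeLT R (g + 1) := by
  rw [uPoly_eq]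
  exact add_mem (mem_degreeLT.2 ((degree_X_pow_le g).trans_lt (by exact_mod_cast g.lt_succ_self)))
    (degreeLT_mono g.le_succ (tangentTriple_mem a).1)

theorem wPoly_mem_degreeLT : wPoly a ∈ degreeLT R (g + 2) := by
  rw [wPoly_eq]
  exact add_mem
    (mem_degreeLT.2 ((degree_X_pow_le _).trans_lt (by exact_mod_cast (g + 1).lt_succ_self)))
    (degreeLT_mono (g + 1).le_succ (tangentTriple_mem a).2.2)

theorem monic_uPoly : (uPoly a).Monic := by
  rw [uPoly_eq]
  exact monic_X_pow_add (mem_degreeLT.1 (tangentTriple_mem a).1)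

theorem monic_wPoly : (wPoly a).Monic := by
  rw [wPoly_eq]
  exact monic_X_pow_add (mem_degreeLT.1 (tangentTriple_mem a).2.2)

/-- The ideal generated by the entries of the matrix `A(x)`. -/
noncomputable def entryIdeal : Ideal R[X] :=
  Ideal.span {uPoly a, vPoly a, wPoly a}

variable [Nontrivial R]

theorem natDegree_uPoly : (uPoly a).natDegree = g := by
  rw [uPoly_eq, natDegree_add_eq_left_of_degree_lt, natDegree_X_pow]
  rw [degree_X_pow]
  exact mem_degreeLT.1 (tangentTriple_mem a).1

theorem natDegree_wPoly : (wPoly a).natDegree = g + 1 := by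
  rw [wPoly_eq, natDegree_add_eq_left_of_degree_lt, natDegree_X_pow]
  rw [degree_X_pow]
  exact mem_degreeLT.1 (tangentTriple_mem a).2.2

theorem natDegree_uPoly_mul_wPoly : (uPoly a * wPoly a).natDegree = 2 * g + 1 := by
  rw [(monic_uPoly a).natDegree_mul (monic_wPoly a), natDegree_uPoly, natDegree_wPoly]
  ring

theorem degree_vPoly_sq_lt : (vPoly a ^ 2).degree < (uPoly a * wPoly a).degree := by
  rw [degree_eq_natDegree ((monic_uPoly a).mul (monic_wPoly a)).ne_zero, natDegree_uPoly_mul_wPoly,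
    sq]
  exact mem_degreeLT.1 (degreeLT_mono (by lia)
    (mul_mem_degreeLT (vPoly_mem_degreeLT a) (degreeLT_mono g.le_succ (vPoly_mem_degreeLT a))))

theorem monic_momentMap : (momentMap a).Monic := by
  rw [momentMap_eq]
  exact ((monic_uPoly a).mul (monic_wPoly a)).add_of_left (degree_vPoly_sq_lt a)

theorem natDegree_momentMap : (momentMap a).natDegree = 2 * g + 1 := by
  rw [momentMap_eq, natDegree_add_eq_left_of_degree_lt (degree_vPoly_sq_lt a),
    natDegree_uPoly_mul_wPoly]

theorem momentMap_eq_iff {p : R[X]} (hp : p.Monic) (hdeg : p.natDegree = 2 * g + 1) :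
    momentMap a = p ↔ ∀ i : Fin (2 * g + 1), (momentMap a).coeff i = p.coeff i := by
  refine ⟨fun h i => by rw [h], fun h => ext fun i => ?_⟩
  obtain hi | rfl | hi := lt_trichotomy i (2 * g + 1)
  · exact h ⟨i, hi⟩
  · nth_rw 1 [← natDegree_momentMap a]
    rw [← hdeg, (monic_momentMap a).coeff_natDegree, hp.coeff_natDegree]
  · rw [coeff_eq_zero_of_natDegree_lt (by rwa [natDegree_momentMap]),
      coeff_eq_zero_of_natDegree_lt (by rwa [hdeg])]

end Entries

section LinearSystems

open Matrix

theorem linearIndependent_iff_forall_exists_dotProduct_eq {ι σ K : Type*} [Finite ι] [Fintype σ]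
    [Field K] {f : ι → σ → K} :
    LinearIndependent K f ↔ ∀ q : ι → K, ∃ t : σ → K, ∀ i, t ⬝ᵥ f i = q i := by
  classical
  have := Fintype.ofFinite ι
  refine ⟨fun hf q => ?_, fun h => ?_⟩
  · have hrank : (Matrix.of f).rank = Fintype.card ι := LinearIndependent.rank_matrix hf
    have htop : LinearMap.range (Matrix.of f).mulVecLin = ⊤ :=
      Submodule.eq_top_of_finrank_eq (hrank.trans (Module.finrank_fintype_fun_eq_card K).symm)
    obtain ⟨t, ht⟩ := LinearMap.range_eq_top.1 htop q
    exact ⟨t, fun i => (dotProduct_comm t (f i)).trans (congrFun ht i)⟩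
  · refine Fintype.linearIndependent_iff.2 fun c hc j => ?_
    obtain ⟨t, ht⟩ := h (Pi.single j 1)
    have h0 := congrArg (t ⬝ᵥ ·) hc
    simpa [dotProduct_sum, ht, Pi.single_apply] using h0

end LinearSystems

section FibreIdeal

open Polynomial Matrix

variable {K : Type} [Field K] {g : ℕ}

theorem variation_eq_zero {σ k K : Type*} [Fintype σ] [Field k] [Field K]
    {φ : MvPolynomial σ k →+* K} {t : σ → K} (ht : t ∈ tangentSpace φ) {p : (MvPolynomial σ k)[X]}
    (hp : p.map φ = 0) : variation φ t p = 0 := by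
  ext j
  rw [coeff_variation, coeff_zero]
  exact ht _ (by rw [← coeff_map, hp, coeff_zero])

theorem map_dvd_variation {σ k K : Type*} [Fintype σ] [Field k] [Field K]
    {φ : MvPolynomial σ k →+* K} {t : σ → K} (ht : t ∈ tangentSpace φ) {d : k[X]} (hd : d.Monic)
    {p : (MvPolynomial σ k)[X]} (hdvd : d.map (φ.comp MvPolynomial.C) ∣ p.map φ) :
    d.map (φ.comp MvPolynomial.C) ∣ variation φ t p := by
  let D := d.map (MvPolynomial.C (σ := σ))
  have hD : D.Monic := hd.map _
  have hmap : D.map φ = d.map (φ.comp MvPolynomial.C) := map_map _ _ _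
  have hrem : (p %ₘ D).map φ = 0 := by
    rwa [map_modByMonic φ hD, modByMonic_eq_zero_iff_dvd (hD.map φ), hmap]
  have hvar : variation φ t (p %ₘ D) = 0 := variation_eq_zero ht hrem
  rw [← modByMonic_add_div p D, map_add, hvar, zero_add, variation_mul, variation_map_C, mul_zero,
    add_zero, hmap]
  exact dvd_mul_right _ _

/-- The ideal generated by the equations `h_i(A) = h_i` of the fibre `M_g(h)`. -/
noncomputable def fibreIdeal (g : ℕ) (h : ℂ[X]) : Ideal (MvPolynomial (Coord g) ℂ) :=
  Ideal.span (Set.range fun i : Fin (2 * g + 1) => hFun g i - MvPolynomial.C (h.coeff i))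

variable (φ : MvPolynomial (Coord g) ℂ →+* K) {h : ℂ[X]}

theorem fibreIdeal_le_ker_iff (hh : h ∈ monicPolys g) :
    fibreIdeal g h ≤ RingHom.ker φ ↔
      momentMap (φ ∘ MvPolynomial.X) = h.map (φ.comp MvPolynomial.C) := by
  rw [momentMap_eq_iff _ (hh.1.map _) ((natDegree_map _).trans hh.2), fibreIdeal, Ideal.span_le,
    Set.range_subset_iff]
  refine forall_congr' fun i => ?_
  rw [SetLike.mem_coe, RingHom.mem_ker, map_sub, sub_eq_zero, hFun, ← coeff_map, map_momentMap,
    coeff_map, RingHom.comp_apply]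

theorem two_ne_zero_of_ringHom (φ : MvPolynomial (Coord g) ℂ →+* K) : (2 : K) ≠ 0 := by
  have := charZero_of_injective_ringHom (φ.comp MvPolynomial.C).injective
  exact two_ne_zero

variable (t : Coord g → K)

theorem variation_tangentTriple : (variation φ t (uPoly MvPolynomial.X),
    variation φ t (vPoly MvPolynomial.X), variation φ t (wPoly MvPolynomial.X)) =
      tangentTriple g t := by
  classical
  have hX (m : ℕ) : variation φ t (X ^ m : (MvPolynomial (Coord g) ℂ)[X]) = 0 := by
    simpa using variation_map_C φ t (X ^ m)
  simp only [uPoly_eq, vPoly_eq, wPoly_eq, tangentTriple_apply, map_add, map_sum, hX, zero_add,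
    variation_monomial, polyGrad_X, dotProduct_single_one]

theorem variation_momentMap : variation φ t (momentMap MvPolynomial.X) =
    momentDeriv (uPoly (φ ∘ MvPolynomial.X)) (vPoly (φ ∘ MvPolynomial.X))
      (wPoly (φ ∘ MvPolynomial.X)) (tangentTriple g t) := by
  rw [momentMap_eq, sq, map_add, variation_mul, variation_mul, map_uPoly, map_vPoly, map_wPoly,
    momentDeriv_apply, ← variation_tangentTriple φ]
  ring

theorem dotProduct_polyGrad_hFun (i : ℕ) : t ⬝ᵥ polyGrad φ (hFun g i) =
    (momentDeriv (uPoly (φ ∘ MvPolynomial.X)) (vPoly (φ ∘ MvPolynomial.X))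
      (wPoly (φ ∘ MvPolynomial.X)) (tangentTriple g t)).coeff i := by
  rw [← variation_momentMap, coeff_variation, hFun]

variable {φ} {t}

theorem momentDeriv_tangentTriple_eq_zero (hh : h ∈ monicPolys g)
    (hφ : fibreIdeal g h ≤ RingHom.ker φ) (ht : t ∈ tangentSpace φ) :
    momentDeriv (uPoly (φ ∘ MvPolynomial.X)) (vPoly (φ ∘ MvPolynomial.X))
      (wPoly (φ ∘ MvPolynomial.X)) (tangentTriple g t) = 0 := by
  have hp : (momentMap MvPolynomial.X - h.map (MvPolynomial.C (σ := Coord g))).map φ = 0 := by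
    rw [Polynomial.map_sub, map_momentMap, Polynomial.map_map,
      (fibreIdeal_le_ker_iff φ hh).1 hφ, sub_self]
  rw [← variation_momentMap, ← sub_zero (variation φ t _), ← variation_map_C φ t h, ← map_sub,
    variation_eq_zero ht hp, variation_map_C]

/-- The coefficients of `d` are constants, so a tangent vector changes the entries of `A(x)` by
multiples of `d`: it is `d` times a syzygy of `(w, 2v, u)`. -/
theorem map_tangentTriple_tangentSpace_le (hh : h ∈ monicPolys g)
    (hφ : fibreIdeal g h ≤ RingHom.ker φ) {d : ℂ[X]} (hd : d.Monic) {u v w : K[X]}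
    (hu : uPoly (φ ∘ MvPolynomial.X) = d.map (φ.comp MvPolynomial.C) * u)
    (hv : vPoly (φ ∘ MvPolynomial.X) = d.map (φ.comp MvPolynomial.C) * v)
    (hw : wPoly (φ ∘ MvPolynomial.X) = d.map (φ.comp MvPolynomial.C) * w) {n : ℕ}
    (hn : d.natDegree + n = g) :
    (tangentSpace φ).map (tangentTriple g) ≤
      (degreeLTTriple K n ⊓ LinearMap.ker (momentDeriv u v w)).map
        ((LinearMap.lsmul K[X] (K[X] × K[X] × K[X])
          (d.map (φ.comp MvPolynomial.C))).restrictScalars K) := by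
  rintro _ ⟨t, ht, rfl⟩
  have hzero := momentDeriv_tangentTriple_eq_zero hh hφ ht
  rw [hu, hv, hw] at hzero
  rw [← natDegree_map (φ.comp MvPolynomial.C) (p := d)] at hn
  refine exists_smul_eq_of_momentDeriv_eq_zero (hd.map _) (hn.symm ▸ tangentTriple_mem t) ?_ ?_ ?_
    hzero
  all_goals
    rw [← variation_tangentTriple φ]
    refine map_dvd_variation ht hd ?_
  · exact ⟨u, by rw [map_uPoly, hu]⟩
  · exact ⟨v, by rw [map_vPoly, hv]⟩
  · exact ⟨w, by rw [map_wPoly, hw]⟩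

theorem finrank_tangentSpace_add_natDegree_le (hh : h ∈ monicPolys g)
    (hφ : fibreIdeal g h ≤ RingHom.ker φ) {d : ℂ[X]} (hd : d.Monic) {u v w : K[X]}
    (hu : uPoly (φ ∘ MvPolynomial.X) = d.map (φ.comp MvPolynomial.C) * u)
    (hv : vPoly (φ ∘ MvPolynomial.X) = d.map (φ.comp MvPolynomial.C) * v)
    (hw : wPoly (φ ∘ MvPolynomial.X) = d.map (φ.comp MvPolynomial.C) * w)
    (hspan : Ideal.span {u, v, w} = ⊤) :
    Module.finrank K (tangentSpace φ) + d.natDegree ≤ g := by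
  have hD : (d.map (φ.comp MvPolynomial.C)).Monic := hd.map _
  have humonic : u.Monic := hD.of_mul_monic_left (hu ▸ monic_uPoly _)
  have hg : (d.map (φ.comp MvPolynomial.C)).natDegree + u.natDegree = g := by
    rw [← hD.natDegree_mul humonic, ← hu, natDegree_uPoly]
  have hvdeg : v ∈ degreeLT K u.natDegree := by
    rw [← monic_mul_mem_degreeLT_iff hD, hg, ← hv]
    exact vPoly_mem_degreeLT _
  have hwdeg : w ∈ degreeLT K (u.natDegree + 2) := by
    rw [← monic_mul_mem_degreeLT_iff hD, ← add_assoc, hg, ← hw]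
    exact wPoly_mem_degreeLT _
  rw [natDegree_map] at hg
  have hrank : Module.finrank K (tangentSpace φ) ≤ u.natDegree := calc
    _ = Module.finrank K ((tangentSpace φ).map (tangentTriple g)) :=
      (Submodule.equivMapOfInjective _ (tangentTriple_injective g) _).finrank_eq
    _ ≤ _ := Submodule.finrank_mono (map_tangentTriple_tangentSpace_le hh hφ hd hu hv hw hg)
    _ ≤ _ := Submodule.finrank_map_le _ _
    _ ≤ _ := finrank_degreeLTTriple_inf_ker_momentDeriv_le (two_ne_zero_of_ringHom φ) humonic rfl
      hvdeg hwdeg hspan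
  lia

theorem exists_entryIdeal_eq_span_and_finrank_tangentSpace_le (hh : h ∈ monicPolys g)
    (hφ : fibreIdeal g h ≤ RingHom.ker φ) :
    ∃ d : ℂ[X], d.Monic ∧
      entryIdeal (φ ∘ MvPolynomial.X) = Ideal.span {d.map (φ.comp MvPolynomial.C)} ∧
      Module.finrank K (tangentSpace φ) + d.natDegree ≤ g := by
  obtain ⟨D, u, v, w, hD, hu, hv, hw, hspan, hspanD⟩ :=
    exists_monic_common_factor (V := vPoly (φ ∘ MvPolynomial.X))
      (W := wPoly (φ ∘ MvPolynomial.X)) (monic_uPoly _).ne_zero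
  have hdvd : D ∣ h.map (φ.comp MvPolynomial.C) := by
    rw [← (fibreIdeal_le_ker_iff φ hh).1 hφ, momentMap_eq, hu, hv, sq, mul_assoc, mul_assoc]
    exact dvd_add (dvd_mul_right _ _) (dvd_mul_right _ _)
  obtain ⟨d, hd, rfl⟩ := exists_monic_map_eq_of_dvd hh.1 hD hdvd
  exact ⟨d, hd, hspanD, finrank_tangentSpace_add_natDegree_le hh hφ hd hu hv hw hspan⟩

end FibreIdeal

section Reduced

open Polynomial Matrix

theorem ncard_range_le_card {ι α : Type*} [Fintype ι] (f : ι → α) :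
    (Set.range f).ncard ≤ Fintype.card ι := by
  rw [← Set.image_univ, ← Nat.card_eq_fintype_card, ← Set.ncard_univ]
  exact Set.ncard_image_le Set.finite_univ

theorem card_coord (g : ℕ) : Fintype.card (Coord g) = 3 * g + 1 := by
  simp only [Fintype.card_sum, Fintype.card_fin]
  ring

variable {K : Type} [Field K] {g : ℕ} {φ : MvPolynomial (Coord g) ℂ →+* K} {h : ℂ[X]}

theorem le_height_ker (hh : h ∈ monicPolys g) (hφ : fibreIdeal g h ≤ RingHom.ker φ) :
    ((2 * g + 1 : ℕ) : ℕ∞) ≤ (RingHom.ker φ).height := by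
  obtain ⟨d, -, -, hd⟩ := exists_entryIdeal_eq_span_and_finrank_tangentSpace_le hh hφ
  have hcard := card_le_height_ker_add_finrank_tangentSpace (φ := φ)
  rw [card_coord] at hcard
  cases hn : (RingHom.ker φ).height with
  | top => exact le_top
  | coe n =>
    rw [hn] at hcard
    norm_cast at hcard ⊢
    lia

theorem entryIdeal_eq_top_of_height_ker_le (hh : h ∈ monicPolys g)
    (hφ : fibreIdeal g h ≤ RingHom.ker φ)
    (hheight : (RingHom.ker φ).height ≤ ((2 * g + 1 : ℕ) : ℕ∞)) :
    entryIdeal (φ ∘ MvPolynomial.X) = ⊤ := by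
  obtain ⟨d, hd, hspan, hrank⟩ := exists_entryIdeal_eq_span_and_finrank_tangentSpace_le hh hφ
  have hcard := card_le_height_ker_add_finrank_tangentSpace (φ := φ) |>.trans
    (add_le_add_left hheight _)
  rw [card_coord] at hcard
  norm_cast at hcard
  have hd1 : d = 1 := hd.natDegree_eq_zero.1 (by lia)
  rw [hspan, hd1, Polynomial.map_one, Ideal.span_singleton_one]

theorem linearIndependent_polyGrad_hFun_iff :
    LinearIndependent K (fun i : Fin (2 * g + 1) => polyGrad φ (hFun g i)) ↔
      entryIdeal (φ ∘ MvPolynomial.X) = ⊤ := by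
  rw [linearIndependent_iff_forall_exists_dotProduct_eq]
  simp only [dotProduct_polyGrad_hFun]
  constructor
  · intro hsurj
    obtain ⟨t, ht⟩ := hsurj fun i => (1 : K[X]).coeff i
    have hone : momentDeriv (uPoly (φ ∘ MvPolynomial.X)) (vPoly (φ ∘ MvPolynomial.X))
        (wPoly (φ ∘ MvPolynomial.X)) (tangentTriple g t) = 1 := by
      have hmem := momentDeriv_mem_degreeLT (uPoly_mem_degreeLT (φ ∘ MvPolynomial.X))
        (degreeLT_mono g.le_succ (vPoly_mem_degreeLT (φ ∘ MvPolynomial.X)))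
        (wPoly_mem_degreeLT (φ ∘ MvPolynomial.X)) (tangentTriple_mem t)
      have hone : (1 : K[X]) ∈ degreeLT K (2 * g + 1) :=
        mem_degreeLT.2 (degree_one.trans_lt (by exact_mod_cast Nat.succ_pos _))
      exact congrArg Subtype.val ((degreeLTEquiv K (2 * g + 1)).injective
        (a₁ := ⟨_, hmem⟩) (a₂ := ⟨1, hone⟩) (funext ht))
    rw [Ideal.eq_top_iff_one, ← hone, momentDeriv_apply]
    refine add_mem (Ideal.mul_mem_right _ _ (Ideal.subset_span (by simp))) (add_mem
      (Ideal.mul_mem_right _ _ (Ideal.mul_mem_left _ _ (Ideal.subset_span (by simp))))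
      (Ideal.mul_mem_right _ _ (Ideal.subset_span (by simp))))
  · intro htop q
    obtain ⟨x, hx, hq⟩ := exists_momentDeriv_eq (two_ne_zero_of_ringHom φ)
      (monic_uPoly (φ ∘ MvPolynomial.X)) (natDegree_uPoly _) (vPoly_mem_degreeLT _)
      (wPoly_mem_degreeLT _) htop ((degreeLTEquiv K (2 * g + 1)).symm q).2
    rw [← range_tangentTriple] at hx
    obtain ⟨t, rfl⟩ := hx
    refine ⟨t, fun i => ?_⟩
    rw [hq]
    exact congrFun ((degreeLTEquiv K (2 * g + 1)).apply_symm_apply q) i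

theorem exists_mul_mem_fibreIdeal (hh : h ∈ monicPolys g) (hφ : fibreIdeal g h ≤ RingHom.ker φ)
    (hheight : (RingHom.ker φ).height = ((2 * g + 1 : ℕ) : ℕ∞)) {F : MvPolynomial (Coord g) ℂ}
    (hF : φ F = 0) : ∃ s, φ s ≠ 0 ∧ s * F ∈ fibreIdeal g h := by
  have hli := linearIndependent_polyGrad_hFun_iff.2
    (entryIdeal_eq_top_of_height_ker_le hh hφ hheight.le)
  refine exists_mul_mem_span_of_linearIndependent
    (fun i => hφ (Ideal.subset_span (Set.mem_range_self i))) ?_ ?_ hF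
  · simpa only [polyGrad_sub_C] using hli
  · rwa [Fintype.card_fin]

theorem le_height_of_fibreIdeal_le (hh : h ∈ monicPolys g) {P : Ideal (MvPolynomial (Coord g) ℂ)}
    [P.IsPrime] (hP : fibreIdeal g h ≤ P) : ((2 * g + 1 : ℕ) : ℕ∞) ≤ P.height := by
  rw [← Ideal.ker_algebraMap_residueField P] at hP ⊢
  exact le_height_ker hh hP

theorem le_height_fibreIdeal (hh : h ∈ monicPolys g) :
    ((2 * g + 1 : ℕ) : ℕ∞) ≤ (fibreIdeal g h).height := by
  rw [Ideal.height_eq_inf_minimalPrimes]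
  refine le_iInf₂ fun P hP => ?_
  have := hP.isPrime
  exact le_height_of_fibreIdeal_le hh hP.1.2

theorem isRadical_fibreIdeal (hh : h ∈ monicPolys g) : (fibreIdeal g h).IsRadical := by
  let xs := List.ofFn fun i : Fin (2 * g + 1) => hFun g i - MvPolynomial.C (h.coeff i)
  have hxs : Ideal.ofList xs = fibreIdeal g h := by
    simp only [Ideal.ofList, fibreIdeal, xs, List.mem_ofFn', Set.ofPred_mem_eq]
  have hlen : xs.length = 2 * g + 1 := List.length_ofFn
  rintro F ⟨n, hn⟩
  refine mem_of_forall_associatedPrimes fun Q hQ => ?_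
  have := hQ.isPrime
  have hle : fibreIdeal g h ≤ Q := by
    rw [← Ideal.annihilator_quotient (I := fibreIdeal g h), ← Submodule.annihilator_top]
    exact hQ.annihilator_le
  have hheight : Q.height = ((2 * g + 1 : ℕ) : ℕ∞) := by
    rw [← hlen]
    rw [← hxs] at hQ
    refine height_eq_length_of_mem_associatedPrimes ?_ hQ
    rw [hxs, hlen]
    exact le_height_fibreIdeal hh
  have hF : F ∈ Q := this.mem_of_pow_mem n (hle hn)
  rw [← Ideal.ker_algebraMap_residueField Q] at hle hheight hF ⊢
  exact exists_mul_mem_fibreIdeal hh hle hheight hF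

end Reduced

section Nullstellensatz

variable {σ : Type}

theorem mem_zeroLocus_iff_le_ker_eval {I : Ideal (MvPolynomial σ ℂ)} {p : σ → ℂ} :
    p ∈ MvPolynomial.zeroLocus ℂ I ↔ I ≤ RingHom.ker (MvPolynomial.eval p) := by
  rw [MvPolynomial.mem_zeroLocus_iff]
  simp only [MvPolynomial.aeval_eq_eval]
  rfl

theorem mem_vanishingIdeal_image_coords {S : Set (AffSp σ)} {F : MvPolynomial σ ℂ} :
    F ∈ MvPolynomial.vanishingIdeal ℂ (coords '' S) ↔
      ∀ A ∈ S, MvPolynomial.eval (coords A) F = 0 := by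
  rw [MvPolynomial.mem_vanishingIdeal_iff, Set.forall_mem_image]
  simp only [MvPolynomial.aeval_eq_eval]

theorem mem_of_forall_eval_eq_zero [Finite σ] {P J : Ideal (MvPolynomial σ ℂ)} [hP : P.IsPrime]
    (hJ : ¬J ≤ P) {F : MvPolynomial σ ℂ}
    (hF : ∀ p : σ → ℂ, P ≤ RingHom.ker (MvPolynomial.eval p) →
      ¬J ≤ RingHom.ker (MvPolynomial.eval p) → MvPolynomial.eval p F = 0) : F ∈ P := by
  obtain ⟨s, hsJ, hsP⟩ := SetLike.not_le_iff_exists.1 hJ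
  refine (hP.mem_or_mem (y := s) ?_).resolve_right hsP
  rw [← hP.radical, ← MvPolynomial.vanishingIdeal_zeroLocus_eq_radical (K := ℂ),
    MvPolynomial.mem_vanishingIdeal_iff]
  intro p hp
  change MvPolynomial.eval p _ = 0
  rw [map_mul, mul_eq_zero, or_iff_not_imp_right]
  exact fun hs => hF p (mem_zeroLocus_iff_le_ker_eval.1 hp) fun hJp => hs (hJp hsJ)

end Nullstellensatz

section Density

open Polynomial

variable {R S : Type} [CommRing R] [CommRing S] {g : ℕ}

theorem map_entryIdeal (a : Coord g → R) (f : R →+* S) :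
    (entryIdeal a).map (mapRingHom f) = entryIdeal (f ∘ a) := by
  rw [entryIdeal, entryIdeal, Ideal.map_span, Set.image_insert_eq, Set.image_pair,
    coe_mapRingHom, map_uPoly, map_vPoly, map_wPoly]

theorem eval_momentMap_eq_zero {a : Coord g → R} {x : R}
    (hx : entryIdeal a ≤ RingHom.ker (evalRingHom x)) : (momentMap a).eval x = 0 := by
  have hu : (uPoly a).eval x = 0 := hx (Ideal.subset_span (by simp))
  have hv : (vPoly a).eval x = 0 := hx (Ideal.subset_span (by simp))
  rw [momentMap_eq, eval_add, eval_mul, eval_pow, hu, hv]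
  ring

theorem exists_le_ker_evalRingHom_of_ne_top {K : Type*} [Field K] [IsAlgClosed K] {I : Ideal K[X]}
    (hI : I ≠ ⊤) : ∃ x : K, I ≤ RingHom.ker (evalRingHom x) := by
  obtain ⟨d, rfl⟩ := IsPrincipalIdealRing.principal I
  rw [Ideal.submodule_span_eq] at hI ⊢
  have hd : d.degree ≠ 0 := fun hdeg =>
    hI (Ideal.span_singleton_eq_top.2 (isUnit_iff_degree_eq_zero.2 hdeg))
  obtain ⟨x, hx⟩ := IsAlgClosed.exists_root d hd
  exact ⟨x, (Ideal.span_singleton_le_iff_mem _).2 hx⟩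

/-- An ideal of polynomial functions whose zeros in `fibre g h` are the matrices with entries that
have a common root. Such a root is a root of `h`, hence the finite product. -/
noncomputable def commonRootIdeal (g : ℕ) (h : ℂ[X]) : Ideal (MvPolynomial (Coord g) ℂ) :=
  ∏ x ∈ h.roots.toFinset, (entryIdeal MvPolynomial.X).map (evalRingHom (MvPolynomial.C x))

/-- The set of matrices in `fibre g h` whose entries `u`, `v`, `w` are coprime. -/
def coprimeLocus (g : ℕ) (h : ℂ[X]) : Set (PhaseSpace g) :=
  {A ∈ fibre g h | entryIdeal (coords A) = ⊤}

variable {h : ℂ[X]}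

theorem commonRootIdeal_le_ker_iff {K : Type} [Field K] (φ : MvPolynomial (Coord g) ℂ →+* K) :
    commonRootIdeal g h ≤ RingHom.ker φ ↔ ∃ x ∈ h.roots,
      entryIdeal (φ ∘ MvPolynomial.X) ≤ RingHom.ker (evalRingHom (φ (MvPolynomial.C x))) := by
  have hcomp (x : ℂ) : φ.comp (evalRingHom (MvPolynomial.C x)) =
      (evalRingHom (φ (MvPolynomial.C x))).comp (mapRingHom φ) := by
    ext <;> simp
  rw [commonRootIdeal, (RingHom.ker_isPrime φ).prod_le]
  simp only [Multiset.mem_toFinset, ← map_entryIdeal, Ideal.map_le_iff_le_comap,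
    RingHom.comap_ker, hcomp]

theorem not_commonRootIdeal_le_ker {K : Type} [Field K] {φ : MvPolynomial (Coord g) ℂ →+* K}
    (hφ : entryIdeal (φ ∘ MvPolynomial.X) = ⊤) : ¬commonRootIdeal g h ≤ RingHom.ker φ := by
  rw [commonRootIdeal_le_ker_iff, hφ]
  rintro ⟨x, -, hx⟩
  exact RingHom.ker_ne_top _ (top_le_iff.1 hx)

theorem eval_comp_X {σ : Type} (p : σ → ℂ) : MvPolynomial.eval p ∘ MvPolynomial.X = p :=
  funext (MvPolynomial.eval_X (f := p))

theorem fibreIdeal_le_ker_eval_iff (hh : h ∈ monicPolys g) {A : PhaseSpace g} :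
    fibreIdeal g h ≤ RingHom.ker (MvPolynomial.eval (coords A)) ↔ A ∈ fibre g h := by
  have hC : (MvPolynomial.eval (coords A)).comp MvPolynomial.C = RingHom.id ℂ :=
    RingHom.ext (MvPolynomial.eval_C (f := coords A))
  rw [fibreIdeal_le_ker_iff _ hh, eval_comp_X, hC, Polynomial.map_id]
  rfl

theorem mem_coprimeLocus_iff (hh : h ∈ monicPolys g) {A : PhaseSpace g} :
    A ∈ coprimeLocus g h ↔ A ∈ fibre g h ∧
      ¬commonRootIdeal g h ≤ RingHom.ker (MvPolynomial.eval (coords A)) := by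
  refine and_congr_right fun hA => ⟨fun htop => not_commonRootIdeal_le_ker ?_, fun hle => ?_⟩
  · rwa [eval_comp_X]
  · by_contra hne
    obtain ⟨x, hx⟩ := exists_le_ker_evalRingHom_of_ne_top hne
    refine hle ((commonRootIdeal_le_ker_iff _).2 ⟨x, ?_, ?_⟩)
    · rw [mem_roots hh.1.ne_zero, IsRoot, ← show momentMap (coords A) = h from hA]
      exact eval_momentMap_eq_zero hx
    · rwa [eval_comp_X, MvPolynomial.eval_C]

theorem not_commonRootIdeal_le_of_mem_minimalPrimes (hh : h ∈ monicPolys g)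
    {P : Ideal (MvPolynomial (Coord g) ℂ)} (hP : P ∈ (fibreIdeal g h).minimalPrimes) :
    ¬commonRootIdeal g h ≤ P := by
  have := hP.isPrime
  have hheight : P.height ≤ ((2 * g + 1 : ℕ) : ℕ∞) :=
    (Ideal.height_le_card_of_mem_minimalPrimes_span (Set.finite_range _) hP).trans
      (mod_cast (ncard_range_le_card _).trans_eq (Fintype.card_fin _))
  have hle := hP.1.2
  rw [← Ideal.ker_algebraMap_residueField P] at hle hheight ⊢
  exact not_commonRootIdeal_le_ker (entryIdeal_eq_top_of_height_ker_le hh hle hheight)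

theorem vanishingIdeal_eq_fibreIdeal (hh : h ∈ monicPolys g) {S : Set (PhaseSpace g)}
    (hS : coprimeLocus g h ⊆ S) (hSh : S ⊆ fibre g h) :
    MvPolynomial.vanishingIdeal ℂ (coords '' S) = fibreIdeal g h := by
  refine le_antisymm (fun F hF => isRadical_fibreIdeal hh ?_) fun F hF => ?_
  · rw [← Ideal.sInf_minimalPrimes, Ideal.mem_sInf]
    intro P hP
    have := hP.isPrime
    refine mem_of_forall_eval_eq_zero (not_commonRootIdeal_le_of_mem_minimalPrimes hh hP)
      fun p hp hroot => ?_
    exact mem_vanishingIdeal_image_coords.1 hF (coords.symm p) (hS ((mem_coprimeLocus_iff hh).2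
      ⟨(fibreIdeal_le_ker_eval_iff hh).1 (hP.1.2.trans hp), hroot⟩))
  · exact mem_vanishingIdeal_image_coords.2 fun A hA =>
      (fibreIdeal_le_ker_eval_iff hh).2 (hSh hA) hF

end Density

section LocalRing

open IsLocalRing

theorem exists_eval_eq_zero_polyGrad_eq {σ : Type*} [Finite σ] (p v : σ → ℂ) :
    ∃ F, MvPolynomial.eval p F = 0 ∧ polyGrad (MvPolynomial.eval p) F = v := by
  classical
  have := Fintype.ofFinite σ
  refine ⟨∑ c, MvPolynomial.C (v c) * (MvPolynomial.X c - MvPolynomial.C (p c)), by simp, ?_⟩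
  simp only [map_sum, polyGrad_mul, polyGrad_sub_C, polyGrad_X, polyGrad_C, smul_zero, add_zero,
    MvPolynomial.eval_C]
  ext c
  simp [Finset.sum_apply, Pi.single_apply]

variable {σ : Type} [Fintype σ]

theorem height_ker_eval (p : σ → ℂ) :
    (RingHom.ker (MvPolynomial.eval p)).height = Fintype.card σ := by
  apply le_antisymm
  · have hle := Ideal.height_le_ringKrullDim_of_ne_top (RingHom.ker_ne_top (MvPolynomial.eval p))
    rw [MvPolynomial.ringKrullDim_of_isNoetherianRing, ringKrullDim_eq_zero_of_field, zero_add,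
      Nat.card_eq_fintype_card] at hle
    exact_mod_cast hle
  · have hsurj : polyGrad (MvPolynomial.eval p) '' (RingHom.ker (MvPolynomial.eval p) : Set _) =
        Set.univ :=
      Set.eq_univ_of_forall fun v => exists_eval_eq_zero_polyGrad_eq p v
    have hle := finrank_span_polyGrad_le_height (φ := MvPolynomial.eval p)
    rwa [hsurj, Submodule.span_univ, finrank_top, Module.finrank_fintype_fun_eq_card] at hle

theorem le_ringKrullDim_localRingAt {S : Set (AffSp σ)} (p : S) {ι : Type*} [Fintype ι]
    {f : ι → MvPolynomial σ ℂ}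
    (hS : MvPolynomial.vanishingIdeal ℂ (coords '' S) = Ideal.span (Set.range f)) :
    (Fintype.card σ : WithBot ℕ∞) ≤ ringKrullDim (LocalRingAt S p) + Fintype.card ι := by
  have hker : (RingHom.ker (MvPolynomial.eval (coords p.1))).map
      (Ideal.Quotient.mk (MvPolynomial.vanishingIdeal ℂ (coords '' S))) =
        RingHom.ker (evalAt S p) :=
    Ideal.map_comap_of_surjective _ Ideal.Quotient.mk_surjective (RingHom.ker (evalAt S p))
  have hprime := RingHom.ker_isPrime (MvPolynomial.eval (coords p.1))
  have hle := Ideal.height_le_height_add_spanFinrank_of_le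
    (p := RingHom.ker (MvPolynomial.eval (coords p.1)))
    fun F hF => mem_vanishingIdeal_image_coords.1 hF p.1 p.2
  have hcard : (MvPolynomial.vanishingIdeal ℂ (coords '' S)).spanFinrank ≤ Fintype.card ι := by
    rw [hS]
    exact (Submodule.spanFinrank_span_le_ncard_of_finite (Set.finite_range f)).trans
      (ncard_range_le_card f)
  rw [height_ker_eval, hker] at hle
  rw [IsLocalization.AtPrime.ringKrullDim_eq_height (RingHom.ker (evalAt S p)) (LocalRingAt S p)]
  exact_mod_cast hle.trans (by gcongr)

end LocalRing

section Jacobian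

open IsLocalRing

theorem exists_linearIndependent_sumElim {ι K V : Type*} [Fintype ι] [Field K] [AddCommGroup V]
    [Module K V] [FiniteDimensional K V] {v : ι → V} (hv : LinearIndependent K v) {d : ℕ}
    (hd : Module.finrank K V = Fintype.card ι + d) :
    ∃ w : Fin d → V, LinearIndependent K (Sum.elim v w) := by
  obtain ⟨W, hW⟩ := Submodule.exists_isCompl (Submodule.span K (Set.range v))
  have hWd : Module.finrank K W = d := by
    have hadd := Submodule.finrank_add_eq_of_isCompl hW
    rw [finrank_span_eq_card hv] at hadd
    lia
  let b := Module.finBasisOfFinrankEq K W hWd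
  refine ⟨fun i => b i, hv.sum_type (b.linearIndependent.map' W.subtype W.ker_subtype)
    (hW.disjoint.mono_right (Submodule.span_le.2 ?_))⟩
  rintro _ ⟨i, rfl⟩
  exact (b i).2

variable {σ : Type} {S : Set (AffSp σ)} {p : S}

theorem mk_mem_span_range_mk_iff {R ι : Type*} [CommRing R] {I : Ideal R} {z : ι → R} {F : R} :
    Ideal.Quotient.mk I F ∈ Ideal.span (Set.range (Ideal.Quotient.mk I ∘ z)) ↔
      F ∈ I ⊔ Ideal.span (Set.range z) := by
  rw [Set.range_comp, ← Ideal.map_span, ← Ideal.mem_comap,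
    Ideal.comap_map_of_surjective' _ Ideal.Quotient.mk_surjective, Ideal.mk_ker, sup_comm]

theorem exists_generators_ker_eval [Finite σ] (p : S) :
    ∃ z : Fin (maximalIdeal (LocalRingAt S p)).spanFinrank → MvPolynomial σ ℂ,
      (∀ i, MvPolynomial.eval (coords p.1) (z i) = 0) ∧
      ∀ F, MvPolynomial.eval (coords p.1) F = 0 → ∃ s, MvPolynomial.eval (coords p.1) s ≠ 0 ∧
        s * F ∈ MvPolynomial.vanishingIdeal ℂ (coords '' S) ⊔ Ideal.span (Set.range z) := by
  obtain ⟨y, hy, hgen⟩ := exists_generators_localization (RingHom.ker (evalAt S p))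
  choose z hz using fun i => Ideal.Quotient.mk_surjective (y i)
  obtain rfl : Ideal.Quotient.mk _ ∘ z = y := funext hz
  refine ⟨z, hy, fun F hF => ?_⟩
  obtain ⟨s, hs, hsF⟩ := hgen (Ideal.Quotient.mk _ F) hF
  obtain ⟨s, rfl⟩ := Ideal.Quotient.mk_surjective s
  exact ⟨s, hs, mk_mem_span_range_mk_iff.1 hsF⟩

theorem spanFinrank_maximalIdeal_localRingAt_le {ι : Type*} [Fintype ι]
    {z : ι → MvPolynomial σ ℂ} (hz : ∀ F, MvPolynomial.eval (coords p.1) F = 0 →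
      ∃ s, MvPolynomial.eval (coords p.1) s ≠ 0 ∧
        s * F ∈ MvPolynomial.vanishingIdeal ℂ (coords '' S) ⊔ Ideal.span (Set.range z))
    (hz0 : ∀ i, MvPolynomial.eval (coords p.1) (z i) = 0) :
    (maximalIdeal (LocalRingAt S p)).spanFinrank ≤ Fintype.card ι := by
  let z' : ι → CoordRing S := Ideal.Quotient.mk _ ∘ z
  have hmax : maximalIdeal (LocalRingAt S p) =
      Ideal.span (Set.range (algebraMap (CoordRing S) (LocalRingAt S p) ∘ z')) := by
    rw [Set.range_comp, ← Ideal.map_span]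
    refine le_antisymm (maximalIdeal_localization_le_map fun F hF => ?_) ?_
    · obtain ⟨F, rfl⟩ := Ideal.Quotient.mk_surjective F
      obtain ⟨s, hs, hsF⟩ := hz F hF
      exact ⟨Ideal.Quotient.mk _ s, hs, mk_mem_span_range_mk_iff.2 hsF⟩
    · rw [← Localization.AtPrime.map_eq_maximalIdeal]
      exact Ideal.map_mono (Ideal.span_le.2 (Set.forall_mem_range.2 hz0))
  rw [hmax]
  exact (Submodule.spanFinrank_span_le_ncard_of_finite (Set.finite_range _)).trans
    (ncard_range_le_card _)

variable [Fintype σ] {ι : Type*} [Fintype ι] {f : ι → MvPolynomial σ ℂ}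

theorem linearIndependent_polyGrad_of_isSmoothAt
    (hS : MvPolynomial.vanishingIdeal ℂ (coords '' S) = Ideal.span (Set.range f)) {d : ℕ}
    (hd : Fintype.card σ = Fintype.card ι + d) (hdim : ringKrullDim (LocalRingAt S p) = d)
    (hp : IsSmoothAt S p) :
    LinearIndependent ℂ fun i => polyGrad (MvPolynomial.eval (coords p.1)) (f i) := by
  obtain ⟨z, hz, hgen⟩ := exists_generators_ker_eval p
  have hrank : (maximalIdeal (LocalRingAt S p)).spanFinrank = d := by
    exact_mod_cast hp.spanFinrank_maximalIdeal.trans hdim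
  have hy : ∀ y ∈ Set.range (Sum.elim f z), MvPolynomial.eval (coords p.1) y = 0 := by
    rintro _ ⟨i | i, rfl⟩
    · exact mem_vanishingIdeal_image_coords.1 (hS.ge (Ideal.subset_span ⟨i, rfl⟩)) p.1 p.2
    · exact hz i
  have hspan : ⊤ ≤ Submodule.span ℂ
      (Set.range (polyGrad (MvPolynomial.eval (coords p.1)) ∘ Sum.elim f z)) := by
    intro v _
    obtain ⟨F, hF, rfl⟩ := exists_eval_eq_zero_polyGrad_eq (coords p.1) v
    obtain ⟨s, hs, hsF⟩ := hgen F hF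
    have hmem := sup_le_sup_right hS.le _ hsF
    rw [← Ideal.span_union, ← Set.Sum.elim_range] at hmem
    rw [Set.range_comp]
    exact polyGrad_mem_span_of_mul_mem_span hy hF hs hmem
  refine (linearIndependent_of_top_le_span_of_card_eq_finrank hspan ?_).comp Sum.inl
    Sum.inl_injective
  rw [Module.finrank_fintype_fun_eq_card, Fintype.card_sum, Fintype.card_fin, hd, hrank]

theorem isSmoothAt_of_linearIndependent_polyGrad
    (hS : MvPolynomial.vanishingIdeal ℂ (coords '' S) = Ideal.span (Set.range f)) {d : ℕ}
    (hd : Fintype.card σ = Fintype.card ι + d) (hdim : ringKrullDim (LocalRingAt S p) = d)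
    (hli : LinearIndependent ℂ fun i => polyGrad (MvPolynomial.eval (coords p.1)) (f i)) :
    IsSmoothAt S p := by
  obtain ⟨b, hb⟩ := exists_linearIndependent_sumElim hli
    (hd ▸ Module.finrank_fintype_fun_eq_card ℂ)
  choose z hz hzb using fun i => exists_eval_eq_zero_polyGrad_eq (coords p.1) (b i)
  have hy (i) : MvPolynomial.eval (coords p.1) (Sum.elim f z i) = 0 := by
    rcases i with i | i
    · exact mem_vanishingIdeal_image_coords.1 (hS.ge (Ideal.subset_span ⟨i, rfl⟩)) p.1 p.2
    · exact hz i
  have hgrad : (fun i => polyGrad (MvPolynomial.eval (coords p.1)) (Sum.elim f z i)) =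
      Sum.elim (fun i => polyGrad (MvPolynomial.eval (coords p.1)) (f i)) b := by
    ext1 i
    rcases i with i | i
    · rfl
    · exact hzb i
  have hheight : (RingHom.ker (MvPolynomial.eval (coords p.1))).height =
      Fintype.card (ι ⊕ Fin d) := by
    rw [height_ker_eval, hd, Fintype.card_sum, Fintype.card_fin]
  refine IsRegularLocalRing.of_spanFinrank_maximalIdeal_le _ ?_
  rw [hdim, Nat.cast_le, ← Fintype.card_fin d]
  refine spanFinrank_maximalIdeal_localRingAt_le (fun F hF => ?_) hz
  obtain ⟨s, hs, hsF⟩ :=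
    exists_mul_mem_span_of_linearIndependent hy (hgrad ▸ hb) hheight hF
  rw [Set.Sum.elim_range, Ideal.span_union] at hsF
  exact ⟨s, hs, sup_le_sup_right hS.ge _ hsF⟩

end Jacobian

section Fibre

open Polynomial

variable {g : ℕ} {h : ℂ[X]} {S : Set (PhaseSpace g)}

theorem ringKrullDim_coordRing_le (hh : h ∈ monicPolys g)
    (hS : MvPolynomial.vanishingIdeal ℂ (coords '' S) = fibreIdeal g h) :
    ringKrullDim (CoordRing S) ≤ g := by
  have hheight : ((2 * g + 1 : ℕ) : ℕ∞) ≤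
      (MvPolynomial.vanishingIdeal ℂ (coords '' S)).height :=
    hS ▸ le_height_fibreIdeal hh
  have hle := (add_le_add_left (WithBot.coe_le_coe.2 hheight) _).trans
    (height_add_ringKrullDim_quotient_le _)
  rw [MvPolynomial.ringKrullDim_of_isNoetherianRing, ringKrullDim_eq_zero_of_field, zero_add,
    Nat.card_eq_fintype_card, card_coord, show 3 * g + 1 = 2 * g + 1 + g by ring,
    Nat.cast_add] at hle
  exact ENat.WithBot.add_le_add_natCast_left_iff.1 hle

theorem ringKrullDim_localRingAt (hh : h ∈ monicPolys g)
    (hS : MvPolynomial.vanishingIdeal ℂ (coords '' S) = fibreIdeal g h) (p : S) :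
    ringKrullDim (LocalRingAt S p) = g := by
  have hle : ringKrullDim (LocalRingAt S p) ≤ g := by
    refine le_trans ?_ (ringKrullDim_coordRing_le hh hS)
    rw [IsLocalization.AtPrime.ringKrullDim_eq_height (RingHom.ker (evalAt S p))
      (LocalRingAt S p)]
    exact Ideal.height_le_ringKrullDim_of_ne_top (RingHom.ker_ne_top _)
  refine le_antisymm hle ?_
  have hge := le_ringKrullDim_localRingAt p hS
  rw [card_coord, Fintype.card_fin, show 3 * g + 1 = g + (2 * g + 1) by ring, Nat.cast_add] at hge
  exact ENat.WithBot.add_le_add_natCast_right_iff.1 hge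

theorem isSmoothAt_iff (hh : h ∈ monicPolys g)
    (hS : MvPolynomial.vanishingIdeal ℂ (coords '' S) = fibreIdeal g h) (p : S) :
    IsSmoothAt S p ↔ entryIdeal (coords p.1) = ⊤ := by
  have hcard : Fintype.card (Coord g) = Fintype.card (Fin (2 * g + 1)) + g := by
    rw [card_coord, Fintype.card_fin]
    ring
  have hdim := ringKrullDim_localRingAt hh hS p
  have hgrad : (fun i : Fin (2 * g + 1) => polyGrad (MvPolynomial.eval (coords p.1)) (hFun g i)) =
      fun i : Fin (2 * g + 1) => polyGrad (MvPolynomial.eval (coords p.1))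
        (hFun g i - MvPolynomial.C (h.coeff i)) :=
    funext fun i => (polyGrad_sub_C _ _).symm
  rw [← eval_comp_X (coords p.1), ← linearIndependent_polyGrad_hFun_iff, hgrad]
  exact ⟨linearIndependent_polyGrad_of_isSmoothAt hS hcard hdim,
    isSmoothAt_of_linearIndependent_polyGrad hS hcard hdim⟩

end Fibre

section Tails

open Polynomial

variable {R : Type*} [CommRing R]

theorem coeff_modByMonic_X_pow_of_lt (p : R[X]) {n k : ℕ} (hk : k < n) :
    (p %ₘ X ^ n).coeff k = p.coeff k := by
  conv_rhs => rw [← modByMonic_add_div p (X ^ n), coeff_add, coeff_X_pow_mul', if_neg hk.not_ge,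
    add_zero]

theorem natDegree_modByMonic_X_pow_succ_le (p : R[X]) (n : ℕ) :
    (p %ₘ X ^ (n + 1)).natDegree ≤ n := by
  nontriviality R
  rw [← Nat.lt_succ_iff]
  simpa only [natDegree_X_pow] using
    natDegree_modByMonic_lt p (monic_X_pow (R := R) (n + 1)) fun h => by
      simpa using congrArg natDegree h

theorem coeff_divByMonic_X_pow_succ (p : R[X]) (n k : ℕ) :
    (p /ₘ X ^ (n + 1)).coeff k = p.coeff (n + k + 1) := by
  have hrem : (p %ₘ X ^ (n + 1)).coeff (k + (n + 1)) = 0 :=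
    coeff_eq_zero_of_natDegree_lt ((natDegree_modByMonic_X_pow_succ_le p n).trans_lt (by lia))
  conv_rhs => rw [← modByMonic_add_div p (X ^ (n + 1)), show n + k + 1 = k + (n + 1) by ring,
    coeff_add, hrem, zero_add, coeff_X_pow_mul]

theorem coeff_mul_divByMonic_X_pow_sub {p q : R[X]} {i : ℕ} (hp : p.natDegree ≤ i + 1)
    (hq : q.natDegree ≤ i + 1) (j : ℕ) :
    (q * (p /ₘ X ^ (j + 1)) - p * (q /ₘ X ^ (j + 1))).coeff i =
      p.coeff (i + 1) * q.coeff j - q.coeff (i + 1) * p.coeff j := by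
  have hshift : X ^ (j + 1) * (q * (p /ₘ X ^ (j + 1)) - p * (q /ₘ X ^ (j + 1))) =
      p * (q %ₘ X ^ (j + 1)) - q * (p %ₘ X ^ (j + 1)) := by
    linear_combination q * modByMonic_add_div p (X ^ (j + 1)) -
      p * modByMonic_add_div q (X ^ (j + 1))
  have htop {r s : R[X]} (hr : r.natDegree ≤ i + 1) :
      (r * (s %ₘ X ^ (j + 1))).coeff (i + (j + 1)) = r.coeff (i + 1) * s.coeff j := by
    rw [show i + (j + 1) = i + 1 + j by ring, coeff_mul_add_eq_of_natDegree_le hr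
      (natDegree_modByMonic_X_pow_succ_le s j), coeff_modByMonic_X_pow_of_lt s j.lt_succ_self]
  rw [← coeff_X_pow_mul _ (j + 1), hshift, coeff_sub, htop hp, htop hq]

theorem mem_degreeLT_iff_coeff_eq_zero {p : R[X]} {n : ℕ} :
    p ∈ degreeLT R n ↔ ∀ m, n ≤ m → p.coeff m = 0 :=
  mem_degreeLT.trans (degree_lt_iff_coeff_zero p n)

end Tails

section Hamiltonian

open Polynomial Matrix

variable {g : ℕ} (A : PhaseSpace g)

/-- The Poisson tensor at `A`, as a matrix in the coordinates. -/
noncomputable def poissonMatrix : Matrix (Coord g) (Coord g) ℂ :=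
  .of fun c b => MvPolynomial.eval (coords A) (coordBracket g c b)

theorem hamiltonianField_eq (i : ℕ) : hamiltonianField g i A =
    poissonMatrix A *ᵥ polyGrad (MvPolynomial.eval (coords A)) (hFun g i) := by
  classical
  ext c
  rw [hamiltonianField, poissonBracket, map_sum, Finset.sum_eq_single c]
  · simp [poissonMatrix, mulVec, dotProduct, polyGrad]
  · intro b _ hb
    simp [MvPolynomial.pderiv_X_of_ne hb.symm]
  · simp

/-- The coefficient of `x^i` in this polynomial is the component of `D_i` along the coordinate
`c`: the rows of the Poisson tensor, read as variations of `(u, v, w)`, generate the `D_i`. -/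
noncomputable def fieldPoly (c : Coord g) : ℂ[X] :=
  momentDeriv (uPoly (coords A)) (vPoly (coords A)) (wPoly (coords A))
    (tangentTriple g (poissonMatrix A c))

theorem coeff_fieldPoly (c : Coord g) (i : ℕ) :
    (fieldPoly A c).coeff i = hamiltonianField g i A c := by
  rw [hamiltonianField_eq, mulVec, dotProduct_polyGrad_hFun, eval_comp_X]
  rfl

theorem eval_uFun (k : ℕ) : MvPolynomial.eval (coords A) (uFun g k) =
    (uPoly (coords A)).coeff k := by
  rw [uFun, ← coeff_map, map_uPoly, eval_comp_X]

theorem eval_vFun (k : ℕ) : MvPolynomial.eval (coords A) (vFun g k) =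
    (vPoly (coords A)).coeff k := by
  rw [vFun, ← coeff_map, map_vPoly, eval_comp_X]

theorem eval_wFun (k : ℕ) : MvPolynomial.eval (coords A) (wFun g k) =
    (wPoly (coords A)).coeff k := by
  rw [wFun, ← coeff_map, map_wPoly, eval_comp_X]

theorem coeff_uPoly_self : (uPoly (coords A)).coeff g = 1 := by
  simpa only [natDegree_uPoly] using (monic_uPoly (coords A)).coeff_natDegree

theorem coeff_uPoly_of_lt {k : ℕ} (hk : g < k) : (uPoly (coords A)).coeff k = 0 :=
  coeff_eq_zero_of_natDegree_lt (by rwa [natDegree_uPoly])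

theorem coeff_vPoly_of_le {k : ℕ} (hk : g ≤ k) : (vPoly (coords A)).coeff k = 0 :=
  (mem_degreeLT_iff_coeff_eq_zero.1 (vPoly_mem_degreeLT _)) k hk

theorem coeff_wPoly_succ {k : ℕ} (hk : g ≤ k) :
    (wPoly (coords A)).coeff (k + 1) = (uPoly (coords A)).coeff k := by
  obtain rfl | hlt := hk.eq_or_lt
  · rw [coeff_uPoly_self]
    simpa only [natDegree_wPoly] using (monic_wPoly (coords A)).coeff_natDegree
  · rw [coeff_uPoly_of_lt A hlt, coeff_eq_zero_of_natDegree_lt (by rw [natDegree_wPoly]; lia)]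

theorem fieldPoly_inl (j : Fin g) : fieldPoly A (.inl j) =
    2 * (vPoly (coords A) * (uPoly (coords A) /ₘ X ^ (j + 1 : ℕ)) -
      uPoly (coords A) * (vPoly (coords A) /ₘ X ^ (j + 1 : ℕ))) := by
  have htriple : tangentTriple g (poissonMatrix A (.inl j)) =
      (0, uPoly (coords A) /ₘ X ^ (j + 1 : ℕ), -2 * (vPoly (coords A) /ₘ X ^ (j + 1 : ℕ))) := by
    refine tangentTriple_eq ⟨zero_mem _, ?_, ?_⟩ (fun k => ?_) (fun k => ?_) (fun k => ?_)
    · refine mem_degreeLT_iff_coeff_eq_zero.2 fun m hm => ?_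
      rw [coeff_divByMonic_X_pow_succ, coeff_uPoly_of_lt A (by lia)]
    · refine mem_degreeLT_iff_coeff_eq_zero.2 fun m hm => ?_
      simp [coeff_divByMonic_X_pow_succ, coeff_vPoly_of_le A (show g ≤ j + m + 1 by lia)]
    · simp [poissonMatrix, coordBracket]
    · simp [poissonMatrix, coordBracket, eval_uFun, coeff_divByMonic_X_pow_succ]
    · simp [poissonMatrix, coordBracket, eval_vFun, coeff_divByMonic_X_pow_succ]
  rw [fieldPoly, htriple, momentDeriv_apply]
  ring

theorem fieldPoly_inr_inl (j : Fin g) : fieldPoly A (.inr (.inl j)) =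
    uPoly (coords A) * (wPoly (coords A) /ₘ X ^ (j + 1 : ℕ)) -
      wPoly (coords A) * (uPoly (coords A) /ₘ X ^ (j + 1 : ℕ)) -
      C ((uPoly (coords A)).coeff j) * uPoly (coords A) := by
  have htriple : tangentTriple g (poissonMatrix A (.inr (.inl j))) =
      (-(uPoly (coords A) /ₘ X ^ (j + 1 : ℕ)), 0,
        wPoly (coords A) /ₘ X ^ (j + 1 : ℕ) - C ((uPoly (coords A)).coeff j)) := by
    refine tangentTriple_eq ⟨?_, zero_mem _, ?_⟩ (fun k => ?_) (fun k => ?_) (fun k => ?_)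
    · refine mem_degreeLT_iff_coeff_eq_zero.2 fun m hm => ?_
      simp [coeff_divByMonic_X_pow_succ, coeff_uPoly_of_lt A (show g < j + m + 1 by lia)]
    · refine mem_degreeLT_iff_coeff_eq_zero.2 fun m hm => ?_
      simp [coeff_divByMonic_X_pow_succ, coeff_wPoly_succ A (show g ≤ j + m by lia),
        coeff_uPoly_of_lt A (show g < j + m by lia), coeff_C, show m ≠ 0 by lia]
    · simp [poissonMatrix, coordBracket, eval_uFun, coeff_divByMonic_X_pow_succ, add_comm]
    · simp [poissonMatrix, coordBracket]
    · simp [poissonMatrix, coordBracket, eval_uFun, eval_wFun, coeff_divByMonic_X_pow_succ,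
        coeff_C, apply_ite (MvPolynomial.eval (coords A))]
  rw [fieldPoly, htriple, momentDeriv_apply]
  ring

theorem fieldPoly_inr_inr (j : Fin (g + 1)) : fieldPoly A (.inr (.inr j)) =
    2 * (wPoly (coords A) * (vPoly (coords A) /ₘ X ^ (j + 1 : ℕ)) -
      vPoly (coords A) * (wPoly (coords A) /ₘ X ^ (j + 1 : ℕ)) +
      C ((vPoly (coords A)).coeff j) * uPoly (coords A)) := by
  obtain ⟨δ, hδ⟩ : ∃ δ : ℂ, δ = if (j : ℕ) = 0 then 1 else 0 := ⟨_, rfl⟩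
  have hcoeff (m : ℕ) : (C δ * uPoly (coords A) - wPoly (coords A) /ₘ X ^ (j + 1 : ℕ)).coeff m =
      δ * (uPoly (coords A)).coeff m - (wPoly (coords A)).coeff (j + m + 1) := by
    rw [coeff_sub, coeff_C_mul, coeff_divByMonic_X_pow_succ]
  have htriple : tangentTriple g (poissonMatrix A (.inr (.inr j))) =
      (2 * (vPoly (coords A) /ₘ X ^ (j + 1 : ℕ)),
        C δ * uPoly (coords A) - wPoly (coords A) /ₘ X ^ (j + 1 : ℕ),
        2 * (C ((vPoly (coords A)).coeff j) - C δ * vPoly (coords A))) := by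
    refine tangentTriple_eq ⟨?_, ?_, ?_⟩ (fun k => ?_) (fun k => ?_) (fun k => ?_)
    · refine mem_degreeLT_iff_coeff_eq_zero.2 fun m hm => ?_
      simp [coeff_divByMonic_X_pow_succ, coeff_vPoly_of_le A (show g ≤ j + m + 1 by lia)]
    · refine mem_degreeLT_iff_coeff_eq_zero.2 fun m hm => ?_
      obtain hj | hj := Nat.eq_zero_or_pos (j : ℕ)
      · rw [hcoeff, hδ, if_pos hj, hj, zero_add, coeff_wPoly_succ A hm, one_mul, sub_self]
      · rw [hcoeff, hδ, if_neg hj.ne', coeff_wPoly_succ A (by lia), zero_mul,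
          coeff_uPoly_of_lt A (by lia), sub_zero]
    · refine mem_degreeLT_iff_coeff_eq_zero.2 fun m hm => ?_
      simp [coeff_C, coeff_vPoly_of_le A (show g ≤ m by lia), show m ≠ 0 by lia]
    · simp [poissonMatrix, coordBracket, eval_vFun, coeff_divByMonic_X_pow_succ, add_comm]
    · rw [hcoeff, hδ]
      simp [poissonMatrix, coordBracket, eval_uFun, eval_wFun, add_comm,
        apply_ite (MvPolynomial.eval (coords A))]
    · rw [← map_ofNat C 2, coeff_C_mul, coeff_sub, coeff_C_mul, hδ]
      simp [poissonMatrix, coordBracket, eval_vFun, coeff_C,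
        apply_ite (MvPolynomial.eval (coords A))]
  rw [fieldPoly, htriple, momentDeriv_apply]
  ring

theorem hamiltonianField_eq_zero {i : ℕ} (hi : g ≤ i) : hamiltonianField g i A = 0 := by
  have hu : (uPoly (coords A)).natDegree ≤ i + 1 := by rw [natDegree_uPoly]; lia
  have hv : (vPoly (coords A)).natDegree ≤ i + 1 :=
    natDegree_le_iff_coeff_eq_zero.2 fun k hk => coeff_vPoly_of_le A (by lia)
  have hw : (wPoly (coords A)).natDegree ≤ i + 1 := by rw [natDegree_wPoly]; lia
  have hui : (uPoly (coords A)).coeff (i + 1) = 0 := coeff_uPoly_of_lt A (by lia)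
  have hvi : (vPoly (coords A)).coeff (i + 1) = 0 := coeff_vPoly_of_le A (by lia)
  have hwi := coeff_wPoly_succ A hi
  ext (j | j | j) <;> rw [← coeff_fieldPoly, Pi.zero_apply]
  · rw [fieldPoly_inl, ← map_ofNat C 2, coeff_C_mul, coeff_mul_divByMonic_X_pow_sub hu hv, hui,
      hvi]
    ring
  · rw [fieldPoly_inr_inl, coeff_sub, coeff_C_mul, coeff_mul_divByMonic_X_pow_sub hw hu, hui, hwi]
    ring
  · rw [fieldPoly_inr_inr, ← map_ofNat C 2, coeff_C_mul, coeff_add, coeff_C_mul,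
      coeff_mul_divByMonic_X_pow_sub hv hw, hvi, hwi]
    ring

theorem sum_pow_smul_hamiltonianField {x : ℂ}
    (hx : entryIdeal (coords A) ≤ RingHom.ker (evalRingHom x)) :
    ∑ i : Fin g, x ^ (i : ℕ) • hamiltonianField g i A = 0 := by
  have hroot {p : ℂ[X]} (hp : p ∈ ({uPoly (coords A), vPoly (coords A), wPoly (coords A)} :
      Set ℂ[X])) : p.eval x = 0 := hx (Ideal.subset_span hp)
  ext c
  have hdeg : fieldPoly A c ∈ degreeLT ℂ g := mem_degreeLT_iff_coeff_eq_zero.2 fun i hi => by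
    rw [coeff_fieldPoly, hamiltonianField_eq_zero A hi, Pi.zero_apply]
  have heval : (fieldPoly A c).eval x = 0 := by simp [fieldPoly, momentDeriv_apply, hroot]
  rw [Finset.sum_apply, Pi.zero_apply, ← heval, eval_eq_sum_degreeLTEquiv hdeg]
  exact Finset.sum_congr rfl fun i _ =>
    (mul_comm _ _).trans (congrArg (· * x ^ (i : ℕ)) (coeff_fieldPoly A c i).symm)

theorem eq_zero_of_sum_shift_mul_eq_zero {U : ℕ → ℂ} (hg : U g = 1) (hU : ∀ k, g < k → U k = 0)
    {a : Fin g → ℂ} (ha : ∀ j : Fin g, ∑ k : Fin g, U (j + k + 1) * a k = 0) : a = 0 := by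
  have key (n : ℕ) : ∀ k : Fin g, (k : ℕ) = n → a k = 0 := by
    induction n using Nat.strong_induction_on with
    | _ n ih =>
      intro k hk
      have h := ha k.rev
      rw [Finset.sum_eq_single k] at h
      · rwa [Fin.val_rev, show g - (k + 1) + k + 1 = g by lia, hg, one_mul] at h
      · intro l _ hl
        obtain hlt | hlt := lt_or_gt_of_ne hl
        · rw [ih l (by lia) l rfl, mul_zero]
        · rw [hU _ (by rw [Fin.val_rev]; lia), zero_mul]
      · simp
  exact funext fun k => key k k rfl

theorem eq_zero_of_poissonMatrix_mulVec_eq_zero {ξ : Coord g → ℂ} (h : poissonMatrix A *ᵥ ξ = 0)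
    (hw : ∀ j, ξ (.inr (.inr j)) = 0) : ξ = 0 := by
  have hv : (fun k => ξ (.inr (.inl k))) = 0 := by
    refine eq_zero_of_sum_shift_mul_eq_zero (coeff_uPoly_self A)
      (fun _ => coeff_uPoly_of_lt A) fun j => ?_
    simpa [mulVec, dotProduct, poissonMatrix, coordBracket, hw, eval_uFun] using congrFun h (.inl j)
  have hu : (fun k => ξ (.inl k)) = 0 := by
    refine eq_zero_of_sum_shift_mul_eq_zero (coeff_uPoly_self A)
      (fun _ => coeff_uPoly_of_lt A) fun j => ?_
    simpa [mulVec, dotProduct, poissonMatrix, coordBracket, hw, eval_uFun, add_comm] using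
      congrFun h (.inr (.inl j))
  ext (j | j | j)
  exacts [congrFun hu j, congrFun hv j, hw j]

theorem finrank_ker_poissonMatrix_le :
    Module.finrank ℂ (LinearMap.ker (poissonMatrix A).mulVecLin) ≤ g + 1 := by
  let wProj : LinearMap.ker (poissonMatrix A).mulVecLin →ₗ[ℂ] (Fin (g + 1) → ℂ) :=
    (LinearMap.funLeft ℂ ℂ (Sum.inr ∘ Sum.inr)).domRestrict _
  have hinj : Function.Injective wProj := (injective_iff_map_eq_zero wProj).2 fun ξ hξ =>
    Subtype.ext (eq_zero_of_poissonMatrix_mulVec_eq_zero A ξ.2 (congrFun hξ))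
  simpa using LinearMap.finrank_le_finrank_of_injective hinj

theorem linearIndependent_hamiltonianField (hA : entryIdeal (coords A) = ⊤) :
    LinearIndependent ℂ fun k : Fin g => hamiltonianField g k A := by
  let grad (i : ℕ) := polyGrad (MvPolynomial.eval (coords A)) (hFun g i)
  let index : Fin g ⊕ Fin (g + 1) ≃ Fin (2 * g + 1) :=
    finSumFinEquiv.trans (finCongr (by ring))
  have hgrad : LinearIndependent ℂ fun k => grad (index k) :=
    (linearIndependent_polyGrad_hFun_iff.2 ((eval_comp_X (coords A)).symm ▸ hA)).comp index
      index.injective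
  obtain ⟨hleft, hright, hdisj⟩ := linearIndependent_sum.1 hgrad
  have hker : Submodule.span ℂ (Set.range ((fun k => grad (index k)) ∘ Sum.inr)) =
      LinearMap.ker (poissonMatrix A).mulVecLin := by
    refine Submodule.eq_of_le_of_finrank_le
      (Submodule.span_le.2 (Set.range_subset_iff.2 fun k => ?_)) ?_
    · exact (hamiltonianField_eq A _).symm.trans (hamiltonianField_eq_zero A (g.le_add_right k))
    · rw [finrank_span_eq_card hright, Fintype.card_fin]
      exact finrank_ker_poissonMatrix_le A
  simp only [hamiltonianField_eq]
  exact hleft.map (f := (poissonMatrix A).mulVecLin) (hker ▸ hdisj)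

theorem mem_stratum_iff : A ∈ stratum g g ↔ entryIdeal (coords A) = ⊤ := by
  have hstratum : A ∈ stratum g g ↔
      LinearIndependent ℂ fun k : Fin g => hamiltonianField g k A := by
    rw [linearIndependent_iff_card_eq_finrank_span, Fintype.card_fin, eq_comm]
    rfl
  rw [hstratum]
  refine ⟨fun hli => ?_, linearIndependent_hamiltonianField A⟩
  by_contra hne
  obtain ⟨x, hx⟩ := exists_le_ker_evalRingHom_of_ne_top hne
  obtain rfl | hg := Nat.eq_zero_or_pos g
  · simpa [uPoly] using hx (Ideal.subset_span (Set.mem_insert (uPoly (coords A)) _))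
  · simpa using Fintype.linearIndependent_iff.1 hli _ (sum_pow_smul_hamiltonianField A hx) ⟨0, hg⟩

theorem fibreStratum_eq_coprimeLocus (h : ℂ[X]) : fibreStratum g g h = coprimeLocus g h :=
  Set.ext fun A => and_congr_right fun _ => mem_stratum_iff A

end Hamiltonian

section Topology

variable {σ : Type} {S T : Set (AffSp σ)}

theorem isClosed_setOf_le_ker_eval (I : Ideal (MvPolynomial σ ℂ)) :
    IsClosed {q : AffSp σ | I ≤ RingHom.ker (MvPolynomial.eval (coords q))} :=
  (isClosed_iff_zeroLocus _).2 ⟨I, Set.ext fun _ => mem_zeroLocus_iff_le_ker_eval.symm⟩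

theorem exists_ideal_mem_iff_le_ker_eval (hS : IsClosed S) :
    ∃ I : Ideal (MvPolynomial σ ℂ), ∀ q, q ∈ S ↔ I ≤ RingHom.ker (MvPolynomial.eval (coords q)) :=
  let ⟨I, hI⟩ := (isClosed_iff_zeroLocus S).1 hS
  ⟨I, fun _ => hI ▸ mem_zeroLocus_iff_le_ker_eval⟩

theorem mem_closure_iff_vanishingIdeal_le {q : AffSp σ} :
    q ∈ closure S ↔ MvPolynomial.vanishingIdeal ℂ (coords '' S) ≤
      RingHom.ker (MvPolynomial.eval (coords q)) := by
  refine ⟨fun hq => closure_minimal (fun p hp F hF => ?_) (isClosed_setOf_le_ker_eval _) hq,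
    fun hq => ?_⟩
  · exact mem_vanishingIdeal_image_coords.1 hF p hp
  · obtain ⟨I, hI⟩ := exists_ideal_mem_iff_le_ker_eval (isClosed_closure (s := S))
    refine (hI q).2 (le_trans (fun F hF => ?_) hq)
    exact mem_vanishingIdeal_image_coords.2 fun p hp => (hI p).1 (subset_closure hp) hF

/-- A point of `S` as a point of the prime spectrum of the coordinate ring. -/
noncomputable def toSpec (S : Set (AffSp σ)) (p : S) : PrimeSpectrum (CoordRing S) :=
  ⟨RingHom.ker (evalAt S p), inferInstance⟩

theorem isInducing_toSpec (S : Set (AffSp σ)) : Topology.IsInducing (toSpec S) := by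
  have hpoint : Topology.IsInducing fun p : AffSp σ =>
    (MvPolynomial.pointToPoint (coords p) : PrimeSpectrum (MvPolynomial σ ℂ)) := ⟨rfl⟩
  rw [(PrimeSpectrum.isClosedEmbedding_comap_of_surjective (CoordRing S) (Ideal.Quotient.mk _)
    Ideal.Quotient.mk_surjective).isInducing.of_comp_iff.symm]
  convert hpoint.comp (Topology.IsInducing.subtypeVal (t := S)) using 1
  funext p
  refine PrimeSpectrum.ext (Ideal.ext fun F => ?_)
  exact (MvPolynomial.mem_vanishingIdeal_singleton_iff (coords p.1) F).symm

theorem dim_le_ringKrullDim (S : Set (AffSp σ)) : dim S ≤ ringKrullDim (CoordRing S) :=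
  (isInducing_toSpec S).topologicalKrullDim_le.trans
    (PrimeSpectrum.topologicalKrullDim_eq_ringKrullDim _).le

theorem dim_mono (h : S ⊆ T) : dim S ≤ dim T :=
  (Topology.IsEmbedding.inclusion h).isInducing.topologicalKrullDim_le

theorem isIrreducible_of_isIrreducible_image {X Y : Type*} [TopologicalSpace X]
    [TopologicalSpace Y] {f : X → Y} (hf : Topology.IsInducing f) {t : Set X}
    (ht : IsIrreducible (f '' t)) : IsIrreducible t := by
  refine ⟨ht.1.of_image, fun u v hu hv hut hvt => ?_⟩
  obtain ⟨U, hU, rfl⟩ := hf.isOpen_iff.1 hu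
  obtain ⟨V, hV, rfl⟩ := hf.isOpen_iff.1 hv
  obtain ⟨_, ⟨x, hx, rfl⟩, hxUV⟩ :=
    ht.2 U V hU hV (Set.image_inter_nonempty_iff.2 hut) (Set.image_inter_nonempty_iff.2 hvt)
  exact ⟨x, hx, hxUV⟩

theorem closure_image_preimage_toSpec [Finite σ] (hS : IsLocallyClosed S) (p : S)
    {Q : PrimeSpectrum (CoordRing S)} (hQ : Q ≤ toSpec S p) :
    closure (toSpec S '' (toSpec S ⁻¹' PrimeSpectrum.zeroLocus Q.asIdeal)) =
      PrimeSpectrum.zeroLocus Q.asIdeal := by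
  refine (closure_minimal (Set.image_preimage_subset _ _)
    (PrimeSpectrum.isClosed_zeroLocus _)).antisymm ?_
  rw [← PrimeSpectrum.zeroLocus_vanishingIdeal_eq_closure]
  refine PrimeSpectrum.zeroLocus_anti_mono fun G hG => ?_
  obtain ⟨F, rfl⟩ := Ideal.Quotient.mk_surjective G
  obtain ⟨J, hJ⟩ :=
    exists_ideal_mem_iff_le_ker_eval (isOpen_compl_iff.1 hS.isOpen_coborder)
  have hSQ : MvPolynomial.vanishingIdeal ℂ (coords '' S) ≤
      Q.asIdeal.comap (Ideal.Quotient.mk _) :=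
    Ideal.mk_ker.ge.trans (Ideal.ker_le_comap _)
  change F ∈ Q.asIdeal.comap (Ideal.Quotient.mk _)
  refine mem_of_forall_eval_eq_zero (J := J)
    (fun hle => ((hJ p.1).2 (hle.trans fun _ hF => hQ hF)).2 p.2) fun q hq hqJ => ?_
  have hqS : coords.symm q ∈ S := by
    by_contra hqS
    exact hqJ ((hJ (coords.symm q)).1
      ⟨mem_closure_iff_vanishingIdeal_le.2 (hSQ.trans hq), hqS⟩)
  have hmem := Ideal.comap_le_comap_iff_of_surjective (Ideal.Quotient.mk _)
    Ideal.Quotient.mk_surjective Q.asIdeal (RingHom.ker (evalAt S ⟨_, hqS⟩)) |>.1 hq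
  exact (PrimeSpectrum.mem_vanishingIdeal _ _).1 hG _ ⟨⟨_, hqS⟩, hmem, rfl⟩

theorem isIrreducible_preimage_toSpec [Finite σ] (hS : IsLocallyClosed S) (p : S)
    {Q : PrimeSpectrum (CoordRing S)} (hQ : Q ≤ toSpec S p) :
    IsIrreducible (toSpec S ⁻¹' PrimeSpectrum.zeroLocus Q.asIdeal) := by
  refine isIrreducible_of_isIrreducible_image (isInducing_toSpec S)
    (isIrreducible_iff_closure.1 ?_)
  rw [closure_image_preimage_toSpec hS p hQ, ← PrimeSpectrum.closure_singleton]
  exact isIrreducible_singleton.closure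

theorem preimage_toSpec_subset_iff [Finite σ] (hS : IsLocallyClosed S) (p : S)
    {Q Q' : PrimeSpectrum (CoordRing S)} (hQ' : Q' ≤ toSpec S p) :
    toSpec S ⁻¹' PrimeSpectrum.zeroLocus Q'.asIdeal ⊆
      toSpec S ⁻¹' PrimeSpectrum.zeroLocus Q.asIdeal ↔ Q ≤ Q' := by
  refine ⟨fun hsub => ?_, fun hle => Set.preimage_mono (PrimeSpectrum.zeroLocus_anti_mono hle)⟩
  have hclosure := closure_minimal (Set.image_subset_iff.2 hsub)
    (PrimeSpectrum.isClosed_zeroLocus (Q.asIdeal : Set (CoordRing S)))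
  rwa [closure_image_preimage_toSpec hS p hQ', PrimeSpectrum.zeroLocus_subset_zeroLocus_iff,
    Q'.isPrime.radical] at hclosure

theorem ringKrullDim_localRingAt_le_dim [Finite σ] (hS : IsLocallyClosed S) (p : S) :
    ringKrullDim (LocalRingAt S p) ≤ dim S := by
  let f : Set.Iic (toSpec S p) → (TopologicalSpace.IrreducibleCloseds S)ᵒᵈ := fun Q =>
    OrderDual.toDual ⟨toSpec S ⁻¹' PrimeSpectrum.zeroLocus Q.1.asIdeal,
      isIrreducible_preimage_toSpec hS p Q.2,
      (PrimeSpectrum.isClosed_zeroLocus _).preimage (isInducing_toSpec S).continuous⟩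
  have hf : StrictMono f := strictMono_of_le_iff_le fun _ Q' =>
    (preimage_toSpec_subset_iff hS p Q'.2).symm
  rw [ringKrullDim, Order.krullDim_eq_of_orderIso
    (IsLocalization.AtPrime.primeSpectrumOrderIso _ (RingHom.ker (evalAt S p)))]
  exact (Order.krullDim_le_of_strictMono f hf).trans Order.krullDim_orderDual.le

end Topology

section CoprimeLocus

open Polynomial

variable {g : ℕ} {h : ℂ[X]}

theorem exists_monic_mul_eq (hh : h ∈ monicPolys g) :
    ∃ u w : ℂ[X], u.Monic ∧ u.natDegree = g ∧ w.Monic ∧ w.natDegree = g + 1 ∧ u * w = h := by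
  have hs := IsAlgClosed.splits h
  have hcard : h.roots.toList.length = 2 * g + 1 := by
    rw [Multiset.length_toList, ← hs.natDegree_eq_card_roots, hh.2]
  let F (l : List ℂ) : ℂ[X] := ((l : Multiset ℂ).map fun a => X - C a).prod
  refine ⟨F (h.roots.toList.take g), F (h.roots.toList.drop g),
    monic_multisetProd_X_sub_C _, ?_, monic_multisetProd_X_sub_C _, ?_, ?_⟩
  · rw [natDegree_multiset_prod_X_sub_C_eq_card, Multiset.coe_card, List.length_take]
    lia
  · rw [natDegree_multiset_prod_X_sub_C_eq_card, Multiset.coe_card, List.length_drop]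
    lia
  · rw [← Multiset.prod_add, ← Multiset.map_add, Multiset.coe_add, List.take_append_drop,
      Multiset.coe_toList]
    exact (hs.eq_prod_roots_of_monic hh.1).symm

theorem fibre_nonempty (hh : h ∈ monicPolys g) : (fibre g h).Nonempty := by
  obtain ⟨u, w, hu, hud, hw, hwd, rfl⟩ := exists_monic_mul_eq hh
  let a : Coord g → ℂ := Sum.elim (fun i => u.coeff i) (Sum.elim 0 fun i => w.coeff i)
  have hua : uPoly a = u := by
    conv_rhs => rw [hu.as_sum, hud, Finset.sum_range]
    rfl
  have hva : vPoly a = 0 := by simp [vPoly, a]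
  have hwa : wPoly a = w := by
    conv_rhs => rw [hw.as_sum, hwd, Finset.sum_range]
    rfl
  refine ⟨coords.symm a, ?_⟩
  change momentMap a = u * w
  rw [momentMap_eq, hua, hva, hwa]
  ring

theorem closure_coprimeLocus (hh : h ∈ monicPolys g) :
    closure (coprimeLocus g h) = fibre g h := by
  ext A
  rw [mem_closure_iff_vanishingIdeal_le,
    vanishingIdeal_eq_fibreIdeal hh subset_rfl fun _ hA => hA.1, fibreIdeal_le_ker_eval_iff hh]

theorem isClosed_fibre (hh : h ∈ monicPolys g) : IsClosed (fibre g h) :=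
  closure_coprimeLocus hh ▸ isClosed_closure

theorem isLocallyClosed_coprimeLocus (hh : h ∈ monicPolys g) :
    IsLocallyClosed (coprimeLocus g h) := by
  convert (isClosed_fibre hh).isLocallyClosed.inter
    (isClosed_setOf_le_ker_eval (commonRootIdeal g h)).isOpen_compl.isLocallyClosed using 1
  exact Set.ext fun A => mem_coprimeLocus_iff hh

theorem le_dim_coprimeLocus (hh : h ∈ monicPolys g) :
    (g : WithBot ℕ∞) ≤ dim (coprimeLocus g h) := by
  obtain ⟨p, hp⟩ : (coprimeLocus g h).Nonempty := by
    rw [← closure_nonempty_iff, closure_coprimeLocus hh]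
    exact fibre_nonempty hh
  rw [← ringKrullDim_localRingAt hh
    (vanishingIdeal_eq_fibreIdeal hh subset_rfl fun _ hA => hA.1) ⟨p, hp⟩]
  exact ringKrullDim_localRingAt_le_dim (isLocallyClosed_coprimeLocus hh) _

theorem dim_eq_of_coprimeLocus_subset (hh : h ∈ monicPolys g) {S : Set (PhaseSpace g)}
    (hS : coprimeLocus g h ⊆ S) (hSh : S ⊆ fibre g h) : dim S = g :=
  ((dim_le_ringKrullDim S).trans
    (ringKrullDim_coordRing_le hh (vanishingIdeal_eq_fibreIdeal hh hS hSh))).antisymm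
    ((le_dim_coprimeLocus hh).trans (dim_mono hS))

theorem isSmoothOfDim_coprimeLocus (hh : h ∈ monicPolys g) :
    IsSmoothOfDim (coprimeLocus g h) g := by
  have hsub : coprimeLocus g h ⊆ fibre g h := fun _ hA => hA.1
  have hV := vanishingIdeal_eq_fibreIdeal hh subset_rfl hsub
  exact ⟨dim_eq_of_coprimeLocus_subset hh subset_rfl hsub, fun p =>
    ⟨(isSmoothAt_iff hh hV p).2 p.2.2, ringKrullDim_localRingAt hh hV p⟩⟩

theorem boundary_coprimeLocus (hh : h ∈ monicPolys g) :
    boundary (coprimeLocus g h) = singularLocus (fibre g h) := by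
  have hV := vanishingIdeal_eq_fibreIdeal hh (fun _ hA => hA.1) (subset_refl (fibre g h))
  rw [boundary, closure_coprimeLocus hh]
  ext A
  refine ⟨fun ⟨hA, hn⟩ => ⟨hA, fun hs => hn ⟨hA, ?_⟩⟩, fun ⟨hA, hs⟩ => ⟨hA, fun hn => hs ?_⟩⟩
  · exact (isSmoothAt_iff hh hV ⟨A, hA⟩).1 hs
  · exact (isSmoothAt_iff hh hV ⟨A, hA⟩).2 hn.2

end CoprimeLocus

end Mumford

theorem proposition3p18 (g : ℕ) (h : Polynomial ℂ) (hh : h ∈ Mumford.monicPolys g) :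
    (Mumford.IsQuasiAffineVariety (Mumford.fibreStratum g g h) ∧
      Mumford.IsSmoothOfDim (Mumford.fibreStratum g g h) g) ∧
    Mumford.boundary (Mumford.fibreStratum g g h) =
      Mumford.singularLocus (Mumford.fibre g h) ∧
    (Mumford.IsAffineVariety (Mumford.fibre g h) ∧ Mumford.dim (Mumford.fibre g h) = g) := by
  open Mumford in
  rw [fibreStratum_eq_coprimeLocus]
  exact ⟨⟨isLocallyClosed_coprimeLocus hh, isSmoothOfDim_coprimeLocus hh⟩,
    boundary_coprimeLocus hh, isClosed_fibre hh,
    dim_eq_of_coprimeLocus_subset hh (fun _ hA => hA.1) subset_rfl⟩
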